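/- Let $E$ be a Euclidean space of dimension $n\ge 1$ with its Lebesgue measure and a fixed orthonormal basis, let $K\ge 1$, $a\ge 0$, $0<L_-\le L_+$ and $0<\lambda_-\le\lambda_+$. Let $\mathcal A(\lambda_-,\lambda_+,n)$ be the set of diagonal $n\times n$ matrices of determinant $1$ with diagonal entries in $[\lambda_-,\lambda_+]$, and let $\Phi_{\mu,\Sigma}$ be the Gaussian density on $E$ with mean $\mu$ and covariance matrix $\Sigma$ (in the fixed basis). Each of the four letters $\mu,L,D,A$ is given one of three types: known (index $0$; a $K$-tuple of values is prescribed), common (no index; one unknown value shared by the $K$ classes) or free (index $K$; one unknown value per class). The family $\mathcal G=\mathcal G_{[\mu_\star L_\star D_\star A_\star]^K_E}$ is the set of all $K$-tuples $(\Phi_{\mu_1,\Sigma_1},\dots,\Phi_{\mu_K,\Sigma_K})$ with $\Sigma_k=L_kD_kA_kD_k'$, where $\mu_k\in[-a,a]^n$ (in coordinates), $L_k\in[L_-,L_+]$, $D_k\in SO(n)$, $A_k\in\mathcal A(\lambda_-,\lambda_+,n)$ for every $k$, and where each of the tuples $(\mu_k)_k,(L_k)_k,(D_k)_k,(A_k)_k$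 respects its type. A bracket $[t^-,t^+]$ is a pair of $K$-tuples of nonnegative measurable functions on $E$ with $t_k^-\le t_k^+$ everywhere; it contains $(s_1,\dots,s_K)$ if $t_k^-(y)\le s_k(y)\le t_k^+(y)$ for all $k$ and all $y\in E$. Its width is $d^{\max}(t^-,t^+)=\bigl(\sup_{1\le k\le K}\int_E(\sqrt{t_k^-}-\sqrt{t_k^+})^2\bigr)^{1/2}$. The bracketing entropy $H_{[\cdot],d^{\max}}(\epsilon,\mathcal G)$ is the logarithm of the minimal number of brackets of width smaller than $\epsilon$ such that each element of $\mathcal G$ is contained in one of them (with $\ln 0=-\infty$ and $\ln\infty=\infty$). Put $c_{\mu_\star},c_{L_\star},c_{D_\star},c_{A_\star}=0$, $1$ or $K$ according to whether the letter is known, common or free, and $$R_\mu=\frac{108\,a\,n}{\sqrt{L_-\lambda_-\frac{\lambda_-}{\lambda_+}}},\qquad R_L=39\,\ln\Bigl(\frac{L_+}{L_-}\Bigr)n,$$ $$\mathcal D=c_{\mu_\star}n+c_{L_\star}+c_{D_\star}\frac{n(n-1)}2+c_{A_\star}(n-1),\qquad \mathcal V=c_{\mu_\star}\mathcal V_\mu+c_{L_\star}\mathcal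 V_L+c_{D_\star}\mathcal V_D+c_{A_\star}\mathcal V_A,$$ $$\mathcal V_\mu=n\ln(1+R_\mu),\qquad \mathcal V_L=\ln(1+R_L),$$ $$\mathcal V_D=\frac{n(n-1)}2\Bigl(\frac{2\ln c_S}{n(n-1)}+\ln\Bigl(252\frac{\lambda_+}{\lambda_-}n\Bigr)\Bigr)\ (=0\text{ if }n=1),\qquad \mathcal V_A=(n-1)\ln\Bigl(2+255\frac{\lambda_+}{\lambda_-}\ln\Bigl(\frac{\lambda_+}{\lambda_-}\Bigr)n\Bigr).$$ Then there is a universal constant $c_S>0$ such that, for all data as above and every $\delta\in(0,\sqrt2]$: (i) if $\delta\le 1+R_\mu$ whenever the means are not known, and $\delta\le 1+R_L$ whenever the volumes are not known (both hold automatically for $\delta\le1$), then $$H_{[\cdot],d^{\max}}(\delta/9,\mathcal G)\le\mathcal V+\mathcal D\ln\frac1\delta;$$ (ii) without this restriction, $H_{[\cdot],d^{\max}}(\delta/9,\mathcal G)\le\mathcal V+\mathcal D\max\bigl(\ln\frac1\delta,0\bigr)$. -/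

import Mathlib

open MeasureTheory
open scoped ENNReal

namespace GaussEntropy

noncomputable section

/-! ### Hellinger distance and bracketing entropy of sets of `K`-tuples of functions -/

section Bracketing

variable {E : Type*} [MeasureSpace E] {K : ℕ}

/-- The squared Hellinger distance `d²(s,t) = ∫ |√s - √t|²` with respect to the reference
(Lebesgue) measure, as an extended nonnegative real. -/
def hellingerSq (s t : E → ℝ) : ℝ≥0∞ :=
  ∫⁻ y, ENNReal.ofReal ((Real.sqrt (s y) - Real.sqrt (t y)) ^ 2)

/-- The sup-Hellinger distance between two `K`-tuples: `(sup_k d²(s_k,t_k))^(1/2)`. -/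
def dMax (s t : Fin K → E → ℝ) : ℝ≥0∞ :=
  (⨆ k, hellingerSq (s k) (t k)) ^ (1 / 2 : ℝ)

/-- `[l, u]` is a bracket of `K`-tuples: nonnegative measurable functions (so that the Hellinger
width makes sense) with `l_k ≤ u_k` everywhere, for every `k`. -/
structure IsBracket (l u : Fin K → E → ℝ) : Prop where
  measurable_lower : ∀ k, Measurable (l k)
  measurable_upper : ∀ k, Measurable (u k)
  nonneg : ∀ k y, 0 ≤ l k y
  le : ∀ k y, l k y ≤ u k y

/-- `N` brackets of sup-Hellinger width smaller than `δ` suffice to cover `G`: every tuple of `G`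
lies, componentwise and everywhere, in one of them. -/
def CoveredByBrackets (δ : ℝ) (G : Set (Fin K → E → ℝ)) (N : ℕ) : Prop :=
  ∃ l u : Fin N → Fin K → E → ℝ,
    (∀ j, IsBracket (l j) (u j) ∧ dMax (l j) (u j) < ENNReal.ofReal δ) ∧
    ∀ s ∈ G, ∃ j, ∀ k y, l j k y ≤ s k y ∧ s k y ≤ u j k y

/-- The bracketing number: the minimal number of brackets (`⊤` if no finite number suffices). -/
def bracketingNumber (δ : ℝ) (G : Set (Fin K → E → ℝ)) : ℕ∞ :=
  ⨅ (N : ℕ) (_ : CoveredByBrackets δ G N), (N : ℕ∞)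

/-- The bracketing entropy: the logarithm of the bracketing number (`⊤` if the latter is infinite,
so that an upper bound by a real number contains the finiteness). -/
def bracketingEntropy (δ : ℝ) (G : Set (Fin K → E → ℝ)) : EReal :=
  ENNReal.log ((bracketingNumber δ G : ℕ∞) : ℝ≥0∞)

end Bracketing

/-! ### Structured families of `K`-tuples of Gaussian densities -/

/-- The status of each of the four quantities (means, volumes, eigenvector matrices, normalized
eigenvalues): known, unknown but common to all the classes, or unknown without restriction. -/
inductive Status where
  | known
  | common
  | free

/-- The constraint put by a status on a `K`-tuple `v`, where `v₀` is the value of the tuple if it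
is known. -/
def Status.Holds {X : Type*} {K : ℕ} (m : Status) (v₀ v : Fin K → X) : Prop :=
  match m with
  | .known => v = v₀
  | .common => ∀ j k, v j = v k
  | .free => True

/-- The number of free copies of a quantity: `0` if known, `1` if common, `K` if free. -/
def Status.coeff (m : Status) (K : ℕ) : ℝ :=
  match m with
  | .known => 0
  | .common => 1
  | .free => K

/-- The bounds `a, L₋, L₊, λ₋, λ₊`. -/
structure Bounds where
  a : ℝ
  Lm : ℝ
  Lp : ℝ
  lm : ℝ
  lp : ℝ

/-- The statuses of the four quantities. -/
structure ModelType where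
  mu : Status
  L : Status
  D : Status
  A : Status

/-- A `K`-tuple of parameters `(μ_k, L_k, D_k, A_k)` in dimension `n`; the covariance matrix of
class `k` is `L_k D_k A_k D_kᵀ`, and the diagonal matrix `A_k` is given by its diagonal. -/
structure Params (E : Type*) (K n : ℕ) where
  mu : Fin K → E
  L : Fin K → ℝ
  D : Fin K → Matrix (Fin n) (Fin n) ℝ
  A : Fin K → Fin n → ℝ

/-- The covariance matrix `Σ_k = L_k D_k A_k D_kᵀ`. -/
def Params.cov {E : Type*} {K n : ℕ} (θ : Params E K n) (k : Fin K) :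
    Matrix (Fin n) (Fin n) ℝ :=
  θ.L k • (θ.D k * Matrix.diagonal (θ.A k) * (θ.D k).transpose)

/-- The diagonals of the matrices of `𝒜(λ₋, λ₊, n)`: determinant one and entries in `[λ₋, λ₊]`. -/
def shapeSet (lm lp : ℝ) (n : ℕ) : Set (Fin n → ℝ) :=
  {A | ∏ i, A i = 1 ∧ ∀ i, lm ≤ A i ∧ A i ≤ lp}

section Gaussian

variable {E : Type*} [NormedAddCommGroup E] [InnerProductSpace ℝ E] {K n : ℕ}

/-- The Gaussian density on the `n`-dimensional Euclidean space `E` with mean `μ` and covariance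
matrix `S` in the orthonormal basis `b`. -/
def gaussDensity (b : OrthonormalBasis (Fin n) ℝ E) (μ : E) (S : Matrix (Fin n) (Fin n) ℝ)
    (y : E) : ℝ :=
  (Real.sqrt ((2 * Real.pi) ^ n * S.det))⁻¹ *
    Real.exp (-(1 / 2) *
      dotProduct (fun i => b.repr (y - μ) i) (S⁻¹.mulVec (fun i => b.repr (y - μ) i)))

/-- The parameter set `Θ` of the type `m`, with known values `θ₀` for the known quantities:
coordinates of the means in `[-a, a]`, volumes in `[L₋, L₊]`, rotations `D_k`, normalized
eigenvalues in `𝒜(λ₋, λ₊, n)`. -/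
def paramSet (b : OrthonormalBasis (Fin n) ℝ E) (m : ModelType) (B : Bounds)
    (θ₀ : Params E K n) : Set (Params E K n) :=
  {θ | (∀ k i, |b.repr (θ.mu k) i| ≤ B.a) ∧
    (∀ k, B.Lm ≤ θ.L k ∧ θ.L k ≤ B.Lp) ∧
    (∀ k, θ.D k ∈ Matrix.specialOrthogonalGroup (Fin n) ℝ) ∧
    (∀ k, θ.A k ∈ shapeSet B.lm B.lp n) ∧
    m.mu.Holds θ₀.mu θ.mu ∧ m.L.Holds θ₀.L θ.L ∧ m.D.Holds θ₀.D θ.D ∧ m.A.Holds θ₀.A θ.A}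

/-- The family `𝒢` of the `K`-tuples of Gaussian densities on `E` with parameters in `Θ`. -/
def gaussFamily (b : OrthonormalBasis (Fin n) ℝ E) (m : ModelType) (B : Bounds)
    (θ₀ : Params E K n) : Set (Fin K → E → ℝ) :=
  {s | ∃ θ ∈ paramSet b m B θ₀, s = fun k => gaussDensity b (θ.mu k) (θ.cov k)}

end Gaussian

/-! ### The constants -/

/-- The number `𝒟` of free parameters. -/
def dimTotal (m : ModelType) (K n : ℕ) : ℝ :=
  m.mu.coeff K * n + m.L.coeff K * 1 + m.D.coeff K * ((n : ℝ) * (n - 1) / 2) +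
    m.A.coeff K * ((n : ℝ) - 1)

/-- `108 a n / √(L₋ λ₋ (λ₋ / λ₊))`. -/
def ratioMu (B : Bounds) (n : ℕ) : ℝ :=
  108 * (B.a / Real.sqrt (B.Lm * B.lm * (B.lm / B.lp))) * n

/-- `39 ln(L₊ / L₋) n`. -/
def ratioL (B : Bounds) (n : ℕ) : ℝ :=
  39 * Real.log (B.Lp / B.Lm) * n

def volMu (B : Bounds) (n : ℕ) : ℝ := n * Real.log (1 + ratioMu B n)

def volL (B : Bounds) (n : ℕ) : ℝ := Real.log (1 + ratioL B n)

/-- For `n = 1` (where there is no rotation) the leading factor vanishes and the value is `0`. -/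
def volD (cS : ℝ) (B : Bounds) (n : ℕ) : ℝ :=
  (n : ℝ) * (n - 1) / 2 *
    (2 * Real.log cS / ((n : ℝ) * (n - 1)) + Real.log (252 * (B.lp / B.lm) * n))

def volA (B : Bounds) (n : ℕ) : ℝ :=
  ((n : ℝ) - 1) * Real.log (2 + 255 * (B.lp / B.lm) * Real.log (B.lp / B.lm) * n)

/-- The constant `𝒱`. -/
def volTotal (cS : ℝ) (m : ModelType) (B : Bounds) (K n : ℕ) : ℝ :=
  m.mu.coeff K * volMu B n + m.L.coeff K * volL B n + m.D.coeff K * volD cS B n +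
    m.A.coeff K * volA B n

end

end GaussEntropy

/-!
# Bracketing entropy of structured families of Gaussian densities

A covering of the parameters by small cells is turned into brackets. All the Gaussian densities
whose parameters lie in the cell with center `(μ₀, exp ℓ, R, exp c)` lie between two functions
`C exp (σ w) exp (-½ ∑ exp (-σ εᵢ) exp (-(ℓ + cᵢ)) zᵢ²)`, `σ = ±1`, where `z` is the vector of the
coordinates of `y - μ₀` along the axes `R` (`envelope`, `envelope_le_gaussDensity_le`). Since the
normalized eigenvalues have product one, `w` only contains the errors due to the mean and to the
volume, and a Gaussian integral gives the squared width
`2 cosh (w + ½ ∑ εᵢ) - 2 ∏ (cosh εᵢ)^(-1/2)` (`hellingerSq_envelope_le` bounds it). With the cell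
sizes of `hellingerSq_envelope_cell_le` the width is at most `δ / 10 < δ / 9`.

It remains to count the cells. Means and logarithms of volumes are covered by grids. The logarithms
of the normalized eigenvalues have sum zero: a grid is used for all of them but one, whose error is
then at most the sum of the errors of the others; as the width depends on the sum of the `εᵢ`, this
costs only a factor two (`exists_shape_net`).

For the rotations, the covariance matrix `D A Dᵀ` does not change when the columns of `D` are
multiplied by signs. For a suitable choice of the signs `-1` is not an eigenvalue of `D`
(`exists_sign_det_ne_zero`), so that `D` has an orthogonal square root with nonnegative symmetric
part, and this root is the Cayley transform of a skew-symmetric contraction. Hence, up to signs, the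
rotations lie in the image of the unit ball of the skew-symmetric matrices, a space of dimension
`n (n - 1) / 2`, under a `4`-Lipschitz map, and the volumetric bound for nets of a unit ball gives
a net of `(1 + 8 / η) ^ (n (n - 1) / 2)` points for the operator norm (`exists_orthogonal_net`).
Since the constants `252` and `9` leave room, this is enough for the universal constant `c_S = 1`.
-/

namespace GaussEntropy

open scoped Matrix

/-! ### Orthogonal matrices and the Cayley transform -/

section Orthogonal

open scoped MatrixOrder

variable {n : ℕ}

/-- Some choice of signs on the diagonal makes a matrix invertible: the determinant is affine in
each sign, and the coefficient of the product of all the signs is one. -/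
lemma exists_sign_det_ne_zero (M : Matrix (Fin n) (Fin n) ℝ) :
    ∃ s : Fin n → ℝ, (∀ i, s i = 1 ∨ s i = -1) ∧ (Matrix.diagonal s + M).det ≠ 0 := by
  induction n with
  | zero => exact ⟨fun _ => 1, fun _ => Or.inl rfl, by simp⟩
  | succ n ih =>
    obtain ⟨s, hs, hdet⟩ := ih (M.submatrix Fin.succ Fin.succ)
    have key : ∀ e : ℝ, (Matrix.diagonal (Fin.cons e s : Fin (n + 1) → ℝ) + M).det =
        (Matrix.diagonal (Fin.cons 0 s : Fin (n + 1) → ℝ) + M).det +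
          e * (Matrix.diagonal s + M.submatrix Fin.succ Fin.succ).det := by
      intro e
      have hsub : ∀ (e : ℝ) (j : Fin (n + 1)),
          (Matrix.diagonal (Fin.cons e s : Fin (n + 1) → ℝ) + M).submatrix Fin.succ j.succAbove =
            (Matrix.diagonal (Fin.cons 0 s : Fin (n + 1) → ℝ) + M).submatrix
              Fin.succ j.succAbove := by
        intro e j
        ext a b
        simp only [Matrix.submatrix_apply, Matrix.add_apply, Matrix.diagonal_apply]
        simp
      have hsub0 : (Matrix.diagonal (Fin.cons 0 s : Fin (n + 1) → ℝ) + M).submatrix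
          Fin.succ (Fin.succAbove 0) = Matrix.diagonal s + M.submatrix Fin.succ Fin.succ := by
        ext a b
        simp [Matrix.diagonal_apply]
      rw [Matrix.det_succ_row_zero, Matrix.det_succ_row_zero, Fin.sum_univ_succ,
        Fin.sum_univ_succ]
      simp only [hsub e]
      rw [hsub0]
      simp [(Fin.succ_ne_zero _).symm]
      ring
    by_cases h1 : (Matrix.diagonal (Fin.cons 1 s : Fin (n + 1) → ℝ) + M).det = 0
    · refine ⟨Fin.cons (-1) s, Fin.cases (by simp) (by simpa using hs), fun h2 => hdet ?_⟩
      have e1 := key 1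
      have e2 := key (-1)
      rw [h1] at e1
      rw [h2] at e2
      linarith
    · exact ⟨Fin.cons 1 s, Fin.cases (by simp) (by simpa using hs), h1⟩

lemma diagonal_mul_self_of_sign {s : Fin n → ℝ} (hs : ∀ i, s i = 1 ∨ s i = -1) :
    Matrix.diagonal s * Matrix.diagonal s = 1 := by
  rw [Matrix.diagonal_mul_diagonal, ← Matrix.diagonal_one]
  congr 1
  funext i
  rcases hs i with h | h <;> simp [h]

lemma isUnit_of_mulVec_eq_zero {A : Matrix (Fin n) (Fin n) ℝ}
    (h : ∀ v : Fin n → ℝ, A *ᵥ v = 0 → v = 0) : IsUnit A := by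
  rw [← Matrix.mulVec_injective_iff_isUnit]
  intro v w hvw
  have := h (v - w) (by rw [Matrix.mulVec_sub]; exact sub_eq_zero.2 hvw)
  exact sub_eq_zero.1 this

/-- An orthogonal matrix without the eigenvalue `-1` has an orthogonal square root with nonnegative
symmetric part: the orthogonal factor in the polar decomposition of `1 + Q`. -/
lemma exists_orthogonal_sqrt {Q : Matrix (Fin n) (Fin n) ℝ} (hQ : Qᵀ * Q = 1)
    (hu : IsUnit (1 + Q)) :
    ∃ W : Matrix (Fin n) (Fin n) ℝ, Wᵀ * W = 1 ∧ W * W = Q ∧ (W + Wᵀ).PosSemidef := by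
  have hQ' : Q * Qᵀ = 1 := mul_eq_one_comm.1 hQ
  set M := (1 + Q)ᵀ * (1 + Q) with hM
  have hMexp : M = 2 + Q + Qᵀ := by
    rw [hM, Matrix.transpose_add, Matrix.transpose_one, add_mul, mul_add, mul_add, hQ]
    simp only [one_mul, mul_one]
    rw [show (2 : Matrix (Fin n) (Fin n) ℝ) = 1 + 1 by norm_num]
    abel
  have hMpos : M.PosSemidef := by
    rw [hM, ← Matrix.conjTranspose_eq_transpose_of_trivial]
    exact Matrix.posSemidef_conjTranspose_mul_self (1 + Q)
  have hM0 : 0 ≤ M := Matrix.nonneg_iff_posSemidef.2 hMpos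
  set P := CFC.sqrt M with hP
  have hPP : P * P = M := CFC.sqrt_mul_sqrt_self M hM0
  have hPpos : P.PosSemidef := Matrix.nonneg_iff_posSemidef.1 (CFC.sqrt_nonneg M)
  have hPT : Pᵀ = P := by
    have := hPpos.isHermitian
    rwa [Matrix.IsHermitian, Matrix.conjTranspose_eq_transpose_of_trivial] at this
  have hMQ : Commute M Q := by
    rw [hMexp, Commute, SemiconjBy]
    simp only [add_mul, mul_add, hQ, hQ', two_mul, mul_two]
  have hPQ : Commute P Q := by
    rw [hP, CFC.sqrt_eq_cfc]
    exact hMQ.cfc_nnreal _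
  have hPQT : Commute P Qᵀ := by
    have := congrArg Matrix.transpose hPQ.eq
    rw [Matrix.transpose_mul, Matrix.transpose_mul, hPT] at this
    exact this.symm
  have hMu : IsUnit M := ((Matrix.isUnit_transpose _).2 hu).mul hu
  have hPu : IsUnit P := isUnit_of_mul_isUnit_left (hPP ▸ hMu)
  have hPdet : IsUnit P.det := (Matrix.isUnit_iff_isUnit_det _).1 hPu
  have hPi1 : P * P⁻¹ = 1 := Matrix.mul_nonsing_inv _ hPdet
  have hPi2 : P⁻¹ * P = 1 := Matrix.nonsing_inv_mul _ hPdet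
  have hPiT : (P⁻¹)ᵀ = P⁻¹ := by rw [Matrix.transpose_nonsing_inv, hPT]
  have hcomm : ∀ R : Matrix (Fin n) (Fin n) ℝ, P * R = R * P → P⁻¹ * R = R * P⁻¹ := by
    intro R hR
    calc P⁻¹ * R = P⁻¹ * (R * P) * P⁻¹ := by
            rw [mul_assoc, mul_assoc, hPi1, mul_one]
      _ = R * P⁻¹ := by rw [← hR, ← mul_assoc, hPi2, one_mul]
  have hc1 : P⁻¹ * (1 + Q) = (1 + Q) * P⁻¹ := by
    rw [mul_add, add_mul, hcomm Q hPQ.eq, mul_one, one_mul]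
  have hc2 : P⁻¹ * (1 + Q)ᵀ = (1 + Q)ᵀ * P⁻¹ := by
    rw [Matrix.transpose_add, Matrix.transpose_one, mul_add, add_mul, hcomm Qᵀ hPQT.eq,
      mul_one, one_mul]
  have hWT : ((1 + Q) * P⁻¹)ᵀ = (1 + Q)ᵀ * P⁻¹ := by
    rw [Matrix.transpose_mul, hPiT, hc2]
  have hsq : (1 + Q) * (1 + Q) = Q * M := by
    rw [hMexp]
    simp only [mul_add, add_mul, hQ', one_mul, mul_one, mul_two]
    abel
  have hMPP : M * (P⁻¹ * P⁻¹) = 1 := by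
    rw [← hPP, mul_assoc, ← mul_assoc P P⁻¹, hPi1, one_mul, hPi1]
  refine ⟨(1 + Q) * P⁻¹, ?_, ?_, ?_⟩
  · rw [hWT, mul_assoc, ← mul_assoc P⁻¹, hc1, mul_assoc, ← mul_assoc, ← hM, hMPP]
  · rw [mul_assoc, ← mul_assoc P⁻¹, hc1, mul_assoc, ← mul_assoc, hsq, mul_assoc, hMPP, mul_one]
  · have : (1 + Q) * P⁻¹ + ((1 + Q) * P⁻¹)ᵀ = P := by
      rw [hWT, ← add_mul, Matrix.transpose_add, Matrix.transpose_one]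
      have : 1 + Q + (1 + Qᵀ) = M := by
        rw [hMexp, show (2 : Matrix (Fin n) (Fin n) ℝ) = 1 + 1 by norm_num]; abel
      rw [this, ← hPP, mul_assoc, hPi1, mul_one]
    rw [this]
    exact hPpos

open scoped Matrix.Norms.L2Operator

lemma l2_opNorm_le_of_dotProduct_le {A : Matrix (Fin n) (Fin n) ℝ} {c : ℝ} (hc : 0 ≤ c)
    (h : ∀ v : Fin n → ℝ, (A *ᵥ v) ⬝ᵥ (A *ᵥ v) ≤ c ^ 2 * (v ⬝ᵥ v)) : ‖A‖ ≤ c := by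
  rw [Matrix.cstar_norm_def]
  refine ContinuousLinearMap.opNorm_le_bound _ hc fun x => ?_
  refine abs_le_of_sq_le_sq' ?_ (by positivity) |>.2
  have := h x.ofLp
  rw [mul_pow, EuclideanSpace.real_norm_sq_eq, EuclideanSpace.real_norm_sq_eq]
  simpa [dotProduct, sq, Matrix.ofLp_toEuclideanCLM] using this

/-- The Cayley transform `(1 - X)(1 + X)⁻¹`. -/
noncomputable def cayley (X : Matrix (Fin n) (Fin n) ℝ) : Matrix (Fin n) (Fin n) ℝ :=
  (1 - X) * (1 + X)⁻¹

lemma dotProduct_mulVec_self_of_skew {X : Matrix (Fin n) (Fin n) ℝ} (hX : Xᵀ = -X)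
    (v : Fin n → ℝ) : v ⬝ᵥ (X *ᵥ v) = 0 := by
  have h : v ⬝ᵥ (X *ᵥ v) = -(v ⬝ᵥ (X *ᵥ v)) := by
    conv_lhs => rw [Matrix.dotProduct_mulVec, ← Matrix.mulVec_transpose, hX, Matrix.neg_mulVec,
      neg_dotProduct, dotProduct_comm]
  linarith

lemma one_add_skew_dotProduct {X : Matrix (Fin n) (Fin n) ℝ} (hX : Xᵀ = -X) (v : Fin n → ℝ) :
    ((1 + X) *ᵥ v) ⬝ᵥ ((1 + X) *ᵥ v) = v ⬝ᵥ v + (X *ᵥ v) ⬝ᵥ (X *ᵥ v) := by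
  have h := dotProduct_mulVec_self_of_skew hX v
  rw [Matrix.add_mulVec, Matrix.one_mulVec, add_dotProduct, dotProduct_add, dotProduct_add, h,
    dotProduct_comm (X *ᵥ v) v, h]
  ring

lemma dotProduct_self_nonneg_real (v : Fin n → ℝ) : 0 ≤ v ⬝ᵥ v :=
  Finset.sum_nonneg fun _ _ => mul_self_nonneg _

lemma isUnit_one_add_skew {X : Matrix (Fin n) (Fin n) ℝ} (hX : Xᵀ = -X) : IsUnit (1 + X) := by
  refine isUnit_of_mulVec_eq_zero fun v hv => ?_
  have h := one_add_skew_dotProduct hX v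
  rw [hv, dotProduct_zero] at h
  have h1 := dotProduct_self_nonneg_real v
  have h2 := dotProduct_self_nonneg_real (X *ᵥ v)
  exact dotProduct_self_eq_zero.1 (by linarith)

lemma norm_inv_one_add_skew_le {X : Matrix (Fin n) (Fin n) ℝ} (hX : Xᵀ = -X) :
    ‖(1 + X)⁻¹‖ ≤ 1 := by
  have hu : IsUnit (1 + X).det := (Matrix.isUnit_iff_isUnit_det _).1 (isUnit_one_add_skew hX)
  refine l2_opNorm_le_of_dotProduct_le zero_le_one fun v => ?_
  have h := one_add_skew_dotProduct hX ((1 + X)⁻¹ *ᵥ v)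
  rw [Matrix.mulVec_mulVec, Matrix.mul_nonsing_inv _ hu, Matrix.one_mulVec] at h
  have h2 := dotProduct_self_nonneg_real (X *ᵥ ((1 + X)⁻¹ *ᵥ v))
  linarith

lemma cayley_eq {X : Matrix (Fin n) (Fin n) ℝ} (hX : Xᵀ = -X) :
    cayley X = 2 • (1 + X)⁻¹ - 1 := by
  have hu : IsUnit (1 + X).det := (Matrix.isUnit_iff_isUnit_det _).1 (isUnit_one_add_skew hX)
  rw [cayley, show (1 - X) = 2 • (1 : Matrix (Fin n) (Fin n) ℝ) - (1 + X) by rw [two_smul]; abel,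
    sub_mul, Matrix.mul_nonsing_inv _ hu, smul_mul_assoc, one_mul]

lemma cayley_orthogonal {X : Matrix (Fin n) (Fin n) ℝ} (hX : Xᵀ = -X) :
    (cayley X)ᵀ * cayley X = 1 := by
  have hu : IsUnit (1 + X).det := (Matrix.isUnit_iff_isUnit_det _).1 (isUnit_one_add_skew hX)
  have hT : (1 + X)ᵀ = 1 - X := by
    rw [Matrix.transpose_add, hX, Matrix.transpose_one, sub_eq_add_neg]
  have hu' : IsUnit (1 - X).det := by rw [← hT, Matrix.det_transpose]; exact hu
  have hT' : (1 - X)ᵀ = 1 + X := by rw [← hT, Matrix.transpose_transpose]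
  rw [cayley, Matrix.transpose_mul, Matrix.transpose_nonsing_inv, hT, hT']
  have hcomm : (1 + X) * (1 - X) = (1 - X) * (1 + X) := by noncomm_ring
  rw [mul_assoc, ← mul_assoc (1 + X), hcomm, mul_assoc (1 - X), Matrix.mul_nonsing_inv _ hu,
    mul_one, Matrix.nonsing_inv_mul _ hu']

lemma norm_cayley_sub_le {X Y : Matrix (Fin n) (Fin n) ℝ} (hX : Xᵀ = -X) (hY : Yᵀ = -Y) :
    ‖cayley X - cayley Y‖ ≤ 2 * ‖X - Y‖ := by
  have hu : IsUnit (1 + X).det := (Matrix.isUnit_iff_isUnit_det _).1 (isUnit_one_add_skew hX)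
  have hv : IsUnit (1 + Y).det := (Matrix.isUnit_iff_isUnit_det _).1 (isUnit_one_add_skew hY)
  have : cayley X - cayley Y = (2 : ℝ) • ((1 + X)⁻¹ * (Y - X) * (1 + Y)⁻¹) := by
    rw [cayley_eq hX, cayley_eq hY, show Y - X = (1 + Y) - (1 + X) by abel, mul_sub, sub_mul,
      Matrix.nonsing_inv_mul _ hu, one_mul, mul_assoc, Matrix.mul_nonsing_inv _ hv, mul_one]
    rw [smul_sub, two_smul ℝ, two_smul ℝ, two_smul ℕ, two_smul ℕ]
    abel
  rw [this, norm_smul, Real.norm_ofNat]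
  have h1 := norm_inv_one_add_skew_le hX
  have h2 := norm_inv_one_add_skew_le hY
  calc 2 * ‖(1 + X)⁻¹ * (Y - X) * (1 + Y)⁻¹‖
      ≤ 2 * (1 * ‖Y - X‖ * 1) := by
        gcongr
        refine (norm_mul_le _ _).trans ?_
        gcongr
        refine (norm_mul_le _ _).trans ?_
        gcongr
    _ = 2 * ‖X - Y‖ := by rw [norm_sub_rev]; ring

lemma norm_le_one_of_orthogonal {Q : Matrix (Fin n) (Fin n) ℝ} (hQ : Qᵀ * Q = 1) : ‖Q‖ ≤ 1 := by
  refine l2_opNorm_le_of_dotProduct_le zero_le_one fun v => ?_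
  rw [Matrix.dotProduct_mulVec, Matrix.vecMul_mulVec, ← Matrix.mulVec_transpose]
  simp [hQ]

/-- The map `X ↦ cayley X ^ 2` is `4`-Lipschitz on skew-symmetric matrices. -/
lemma norm_cayley_sq_sub_le {X Y : Matrix (Fin n) (Fin n) ℝ} (hX : Xᵀ = -X) (hY : Yᵀ = -Y) :
    ‖cayley X * cayley X - cayley Y * cayley Y‖ ≤ 4 * ‖X - Y‖ := by
  have h := norm_cayley_sub_le hX hY
  have h1 := norm_le_one_of_orthogonal (cayley_orthogonal hX)
  have h2 := norm_le_one_of_orthogonal (cayley_orthogonal hY)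
  have e : cayley X * cayley X - cayley Y * cayley Y =
      cayley X * (cayley X - cayley Y) + (cayley X - cayley Y) * cayley Y := by noncomm_ring
  calc _ ≤ ‖cayley X‖ * ‖cayley X - cayley Y‖ + ‖cayley X - cayley Y‖ * ‖cayley Y‖ := by
        rw [e]
        exact (norm_add_le _ _).trans (add_le_add (norm_mul_le _ _) (norm_mul_le _ _))
    _ ≤ 1 * (2 * ‖X - Y‖) + (2 * ‖X - Y‖) * 1 := by gcongr
    _ = _ := by ring

/-- An orthogonal matrix with nonnegative symmetric part is the Cayley transform of a
skew-symmetric contraction. -/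
lemma exists_skew_cayley_eq {W : Matrix (Fin n) (Fin n) ℝ} (hW : Wᵀ * W = 1)
    (hpos : (W + Wᵀ).PosSemidef) :
    ∃ X : Matrix (Fin n) (Fin n) ℝ, Xᵀ = -X ∧ ‖X‖ ≤ 1 ∧ cayley X = W := by
  have hW' : W * Wᵀ = 1 := mul_eq_one_comm.1 hW
  have hq : ∀ v : Fin n → ℝ, 0 ≤ v ⬝ᵥ (W *ᵥ v) := by
    intro v
    have h := hpos.dotProduct_mulVec_nonneg v
    rw [star_trivial, Matrix.add_mulVec, dotProduct_add, Matrix.dotProduct_mulVec v Wᵀ,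
      Matrix.vecMul_transpose, dotProduct_comm (W *ᵥ v)] at h
    linarith
  have hWv : ∀ v : Fin n → ℝ, (W *ᵥ v) ⬝ᵥ (W *ᵥ v) = v ⬝ᵥ v := by
    intro v
    rw [Matrix.dotProduct_mulVec, Matrix.vecMul_mulVec, ← Matrix.mulVec_transpose]
    simp [hW]
  have hunit : IsUnit (1 + W) := by
    refine isUnit_of_mulVec_eq_zero fun v hv => ?_
    rw [Matrix.add_mulVec, Matrix.one_mulVec] at hv
    have h1 := hq v
    rw [eq_neg_of_add_eq_zero_right hv, dotProduct_neg] at h1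
    exact dotProduct_self_eq_zero.1 (le_antisymm (by linarith) (dotProduct_self_nonneg_real v))
  have hu : IsUnit (1 + W).det := (Matrix.isUnit_iff_isUnit_det _).1 hunit
  have hi1 := Matrix.mul_nonsing_inv _ hu
  have hi2 := Matrix.nonsing_inv_mul _ hu
  have hcomm : (1 - W) * (1 + W) = (1 + W) * (1 - W) := by noncomm_ring
  have hT : (1 + W)ᵀ = Wᵀ * (1 + W) := by
    rw [Matrix.transpose_add, Matrix.transpose_one, mul_add, hW, mul_one, add_comm]
  have hT2 : (1 - W)ᵀ = -(Wᵀ * (1 - W)) := by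
    rw [Matrix.transpose_sub, Matrix.transpose_one, mul_sub, hW, mul_one, neg_sub]
  have hX1 : 1 + (1 - W) * (1 + W)⁻¹ = 2 • (1 + W)⁻¹ := by
    nth_rewrite 1 [← hi1]
    rw [← add_mul, show 1 + W + (1 - W) = 2 • (1 : Matrix (Fin n) (Fin n) ℝ) by
      rw [two_smul]; abel, smul_mul_assoc, one_mul]
  have hX2 : 1 - (1 - W) * (1 + W)⁻¹ = 2 • (W * (1 + W)⁻¹) := by
    nth_rewrite 1 [← hi1]
    rw [← sub_mul, show 1 + W - (1 - W) = 2 • W by rw [two_smul]; abel, smul_mul_assoc]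
  have hskew : ((1 - W) * (1 + W)⁻¹)ᵀ = -((1 - W) * (1 + W)⁻¹) := by
    have e : (1 + W)ᵀ * ((1 - W) * (1 + W)⁻¹) = -(1 - W)ᵀ := by
      rw [hT, hT2, mul_assoc, ← mul_assoc (1 + W), ← hcomm, mul_assoc (1 - W), hi1, mul_one,
        neg_neg]
    have huT : IsUnit (1 + W)ᵀ.det := by rw [Matrix.det_transpose]; exact hu
    rw [Matrix.transpose_mul, Matrix.transpose_nonsing_inv, ← neg_eq_iff_eq_neg, ← mul_neg, ← e,
      ← mul_assoc, Matrix.nonsing_inv_mul _ huT, one_mul]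
  refine ⟨(1 - W) * (1 + W)⁻¹, hskew, ?_, ?_⟩
  · refine l2_opNorm_le_of_dotProduct_le zero_le_one fun v => ?_
    obtain ⟨u, rfl⟩ : ∃ u, (1 + W) *ᵥ u = v :=
      ⟨(1 + W)⁻¹ *ᵥ v, by rw [Matrix.mulVec_mulVec, hi1, Matrix.one_mulVec]⟩
    rw [Matrix.mulVec_mulVec, mul_assoc, hi2, mul_one, Matrix.add_mulVec, Matrix.sub_mulVec,
      Matrix.one_mulVec]
    have h1 := hq u
    simp only [add_dotProduct, sub_dotProduct, dotProduct_add, dotProduct_sub, hWv,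
      dotProduct_comm (W *ᵥ u) u]
    linarith
  · have h2 : IsUnit (2 : ℝ) := isUnit_iff_ne_zero.2 two_ne_zero
    have hinv : (1 + (1 - W) * (1 + W)⁻¹)⁻¹ = (2 : ℝ)⁻¹ • (1 + W) := by
      refine Matrix.inv_eq_right_inv ?_
      rw [hX1, mul_smul_comm, smul_mul_assoc, hi2, ← ofNat_smul_eq_nsmul ℝ, smul_smul]
      norm_num
    rw [cayley, hinv, hX2, mul_smul_comm, smul_mul_assoc, mul_assoc, hi2, mul_one,
      ← ofNat_smul_eq_nsmul ℝ, smul_smul]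
    norm_num

end Orthogonal

/-! ### Volumetric nets and a net of the rotations -/

section RotationNet

open scoped Matrix.Norms.L2Operator

section Covering

variable {V : Type*} [NormedAddCommGroup V] [NormedSpace ℝ V] [FiniteDimensional ℝ V]

open Metric Module in
/-- A separated subset of the unit ball has few points: the balls of half the separation around
them are disjoint and lie in a slightly larger ball. -/
lemma card_le_of_separated_unitBall {ε : ℝ} (hε : 0 < ε) (T : Finset V) (hT : ∀ x ∈ T, ‖x‖ ≤ 1)
    (hsep : ∀ x ∈ T, ∀ y ∈ T, x ≠ y → ε ≤ ‖x - y‖) :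
    (T.card : ℝ) ≤ (1 + 2 / ε) ^ finrank ℝ V := by
  borelize V
  let μ : Measure V := Measure.addHaar
  have hr : 0 < ε / 2 := by positivity
  have hR : 0 < 1 + ε / 2 := by positivity
  have hD : Set.Pairwise (T : Set V) (Function.onFun Disjoint fun c => ball c (ε / 2)) := by
    intro c hc d hd hcd
    refine ball_disjoint_ball ?_
    rw [dist_eq_norm]
    linarith [hsep c hc d hd hcd]
  have hsub : (⋃ c ∈ T, ball c (ε / 2)) ⊆ ball (0 : V) (1 + ε / 2) := by
    refine Set.iUnion₂_subset fun x hx => ball_subset_ball' ?_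
    rw [dist_zero_right]
    linarith [hT x hx]
  have I : (T.card : ℝ≥0∞) * ENNReal.ofReal ((ε / 2) ^ finrank ℝ V) * μ (ball 0 1) ≤
      ENNReal.ofReal ((1 + ε / 2) ^ finrank ℝ V) * μ (ball 0 1) := by
    calc _ = μ (⋃ c ∈ T, ball c (ε / 2)) := by
          rw [measure_biUnion_finset hD fun c _ => measurableSet_ball]
          simp only [μ.addHaar_ball_of_pos _ hr, Finset.sum_const, nsmul_eq_mul, mul_assoc]
      _ ≤ μ (ball (0 : V) (1 + ε / 2)) := measure_mono hsub
      _ = _ := by simp only [μ.addHaar_ball_of_pos _ hR]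
  have J := (ENNReal.mul_le_mul_iff_left (measure_ball_pos _ _ zero_lt_one).ne'
    measure_ball_lt_top.ne).1 I
  have K := ENNReal.toReal_le_of_le_ofReal (by positivity) J
  rw [ENNReal.toReal_mul, ENNReal.toReal_natCast, ENNReal.toReal_ofReal (by positivity)] at K
  have e : 1 + 2 / ε = (1 + ε / 2) / (ε / 2) := by field_simp; ring
  rw [e, div_pow, le_div_iff₀ (by positivity)]
  exact K

/-- Volumetric bound for the covering numbers of the unit ball of a normed space. -/
lemma exists_finset_cover_unitBall {ε : ℝ} (hε : 0 < ε) :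
    ∃ T : Finset V, (∀ x ∈ T, ‖x‖ ≤ 1) ∧ (∀ x : V, ‖x‖ ≤ 1 → ∃ y ∈ T, ‖x - y‖ ≤ ε) ∧
      (T.card : ℝ) ≤ (1 + 2 / ε) ^ Module.finrank ℝ V := by
  classical
  let P : ℕ → Prop := fun k => ∃ T : Finset V, T.card = k ∧ (∀ x ∈ T, ‖x‖ ≤ 1) ∧
    ∀ x ∈ T, ∀ y ∈ T, x ≠ y → ε ≤ ‖x - y‖
  have hbound : ∀ k, P k → k ≤ ⌊(1 + 2 / ε) ^ Module.finrank ℝ V⌋₊ := by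
    rintro k ⟨T, rfl, h1, h2⟩
    exact Nat.le_floor (card_le_of_separated_unitBall hε T h1 h2)
  have h0 : P 0 := ⟨∅, by simp⟩
  -- a separated set of the largest possible cardinality is a net
  obtain ⟨T, hcard, h1, h2⟩ : P (Nat.findGreatest P ⌊(1 + 2 / ε) ^ Module.finrank ℝ V⌋₊) :=
    Nat.findGreatest_spec (Nat.zero_le _) h0
  refine ⟨T, h1, fun x hx => ?_, card_le_of_separated_unitBall hε T h1 h2⟩
  by_contra! hcon
  have hxT : x ∉ T := fun hxT => by
    have := hcon x hxT
    rw [sub_self, norm_zero] at this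
    exact absurd this hε.not_gt
  have hP : P (T.card + 1) := by
    refine ⟨insert x T, Finset.card_insert_of_notMem hxT, ?_, ?_⟩
    · intro y hy
      rcases Finset.mem_insert.1 hy with rfl | hy
      exacts [hx, h1 y hy]
    · intro y hy z hz hyz
      rcases Finset.mem_insert.1 hy with rfl | hyT <;>
        rcases Finset.mem_insert.1 hz with rfl | hzT
      · exact absurd rfl hyz
      · exact (hcon z hzT).le
      · rw [norm_sub_rev]; exact (hcon y hyT).le
      · exact h2 y hyT z hzT hyz
  have := Nat.le_findGreatest (hbound _ hP) hP
  omega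

end Covering

/-- The space of skew-symmetric matrices. -/
def skewMatrices (n : ℕ) : Submodule ℝ (Matrix (Fin n) (Fin n) ℝ) where
  carrier := {X | Xᵀ = -X}
  add_mem' := by
    intro X Y hX hY
    simp only [Set.mem_ofPred_eq] at *
    rw [Matrix.transpose_add, hX, hY, neg_add]
  zero_mem' := by simp
  smul_mem' := by
    intro c X hX
    simp only [Set.mem_ofPred_eq] at *
    rw [Matrix.transpose_smul, hX, smul_neg]

lemma finrank_skewMatrices_le (n : ℕ) :
    Module.finrank ℝ (skewMatrices n) ≤ n * (n - 1) / 2 := by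
  -- the entries below the diagonal determine a skew-symmetric matrix
  let f : skewMatrices n →ₗ[ℝ] ((Σ j : Fin n, Fin j) → ℝ) :=
    { toFun := fun X p => X.1 p.1 ⟨p.2, p.2.2.trans p.1.2⟩
      map_add' := fun X Y => rfl
      map_smul' := fun c X => rfl }
  have hf : Function.Injective f := by
    rw [← LinearMap.ker_eq_bot, LinearMap.ker_eq_bot']
    intro X hX
    have hlow : ∀ i j : Fin n, j < i → X.1 i j = 0 := fun i j hij =>
      congrFun hX ⟨i, ⟨j, hij⟩⟩
    have hsk : ∀ i j, X.1 j i = -X.1 i j := fun i j => congrFun (congrFun X.2 i) j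
    ext i j
    rcases lt_trichotomy i j with h | h | h
    · have := hsk j i
      rw [hlow j i h, neg_zero] at this
      exact this
    · subst h
      have := hsk i i
      change X.1 i i = 0
      linarith
    · exact hlow i j h
  have := LinearMap.finrank_le_finrank_of_injective hf
  rw [Module.finrank_fintype_fun_eq_card, Fintype.card_sigma] at this
  simp only [Fintype.card_fin] at this
  rwa [Fin.sum_univ_eq_sum_range (fun i => i), Finset.sum_range_id] at this

/-- Up to signs of the columns, the orthogonal matrices have a net of cardinality at most
`(1 + 8 / η) ^ (n (n - 1) / 2)` for the operator norm: up to signs they are values of the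
map `X ↦ cayley X ^ 2` on the unit ball of the skew-symmetric matrices. -/
lemma exists_orthogonal_net (n : ℕ) {η : ℝ} (hη : 0 < η) :
    ∃ T : Finset (Matrix (Fin n) (Fin n) ℝ), (∀ R ∈ T, Rᵀ * R = 1) ∧
      (∀ D : Matrix (Fin n) (Fin n) ℝ, Dᵀ * D = 1 → ∃ R ∈ T, ∃ s : Fin n → ℝ,
        (∀ i, s i = 1 ∨ s i = -1) ∧ ‖Matrix.diagonal s * Dᵀ - Rᵀ‖ ≤ η) ∧
      (T.card : ℝ) ≤ (1 + 8 / η) ^ (n * (n - 1) / 2) := by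
  classical
  obtain ⟨T, hT1, hT2, hT3⟩ := exists_finset_cover_unitBall (V := skewMatrices n)
    (show 0 < η / 4 by positivity)
  refine ⟨T.image fun X => cayley X.1 * cayley X.1, ?_, ?_, ?_⟩
  · intro R hR
    obtain ⟨X, -, rfl⟩ := Finset.mem_image.1 hR
    have h := cayley_orthogonal X.2
    rw [Matrix.transpose_mul, mul_assoc, ← mul_assoc _ (cayley X.1), h, one_mul, h]
  · intro D hD
    obtain ⟨s, hs, hdet⟩ := exists_sign_det_ne_zero D
    have hss := diagonal_mul_self_of_sign hs
    have hQ : (D * Matrix.diagonal s)ᵀ * (D * Matrix.diagonal s) = 1 := by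
      rw [Matrix.transpose_mul, Matrix.diagonal_transpose, mul_assoc, ← mul_assoc Dᵀ, hD, one_mul,
        hss]
    have hu : IsUnit (1 + D * Matrix.diagonal s) := by
      have e : 1 + D * Matrix.diagonal s = (Matrix.diagonal s + D) * Matrix.diagonal s := by
        rw [add_mul, hss]
      rw [e]
      exact ((Matrix.isUnit_iff_isUnit_det _).2 (isUnit_iff_ne_zero.2 hdet)).mul
        (IsUnit.of_mul_eq_one _ hss)
    obtain ⟨W, hW1, hW2, hW3⟩ := exists_orthogonal_sqrt hQ hu
    obtain ⟨X, hX1, hX2, rfl⟩ := exists_skew_cayley_eq hW1 hW3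
    obtain ⟨Y, hY, hXY⟩ := hT2 ⟨X, hX1⟩ hX2
    refine ⟨_, Finset.mem_image_of_mem _ hY, s, hs, ?_⟩
    have e : Matrix.diagonal s * Dᵀ - (cayley Y.1 * cayley Y.1)ᵀ =
        (cayley X * cayley X - cayley Y.1 * cayley Y.1)ᴴ := by
      rw [hW2, Matrix.conjTranspose_eq_transpose_of_trivial, Matrix.transpose_sub,
        Matrix.transpose_mul D, Matrix.diagonal_transpose]
    rw [e, Matrix.l2_opNorm_conjTranspose]
    refine (norm_cayley_sq_sub_le hX1 Y.2).trans ?_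
    have : ‖X - Y.1‖ ≤ η / 4 := hXY
    linarith
  · calc ((T.image fun X => cayley X.1 * cayley X.1).card : ℝ) ≤ T.card := by
          exact_mod_cast Finset.card_image_le
      _ ≤ _ := hT3
      _ ≤ (1 + 2 / (η / 4)) ^ (n * (n - 1) / 2) :=
          pow_le_pow_right₀ (by have : 0 < 2 / (η / 4) := by positivity
                                linarith) (finrank_skewMatrices_le n)
      _ = _ := by congr 2; field_simp; norm_num

end RotationNet

/-! ### Envelopes of Gaussian densities and their Hellinger width -/

section Envelope

variable {E : Type*} [NormedAddCommGroup E] [InnerProductSpace ℝ E] {n : ℕ}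

/-- The coordinates of `y - μ` in the orthonormal basis whose vectors are the columns of `R` (in
the basis `b`). -/
noncomputable def rotCoord (b : OrthonormalBasis (Fin n) ℝ E) (μ : E) (R : Matrix (Fin n) (Fin n) ℝ)
    (y : E) : Fin n → ℝ :=
  Rᵀ *ᵥ fun i => b.repr (y - μ) i

/-- The density with center `μ`, volume `exp ℓ`, axes `R` and logarithmic shape `c`, where the
quadratic form in the exponent is multiplied by `κ i` along the `i`-th axis, but the normalizing
factor is kept. -/
noncomputable def stretchedDensity (b : OrthonormalBasis (Fin n) ℝ E) (μ : E) (ℓ : ℝ)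
    (R : Matrix (Fin n) (Fin n) ℝ) (c κ : Fin n → ℝ) (y : E) : ℝ :=
  (Real.sqrt ((2 * Real.pi) ^ n * Real.exp ℓ ^ n))⁻¹ *
    Real.exp (-(1 / 2) * ∑ i, κ i * Real.exp (-(ℓ + c i)) * rotCoord b μ R y i ^ 2)

/-- The upper (`σ = 1`) and lower (`σ = -1`) envelopes of the Gaussian densities whose parameters
are close to `(μ, exp ℓ, R, exp c)`: `ε i` bounds the relative error along the `i`-th axis and `w`
the error of the logarithm of the density at the center. -/
noncomputable def envelope (b : OrthonormalBasis (Fin n) ℝ E) (μ : E) (ℓ : ℝ)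
    (R : Matrix (Fin n) (Fin n) ℝ) (c ε : Fin n → ℝ) (w σ : ℝ) (y : E) : ℝ :=
  Real.exp (σ * w) * stretchedDensity b μ ℓ R c (fun i => Real.exp (-(σ * ε i))) y

lemma continuous_stretchedDensity (b : OrthonormalBasis (Fin n) ℝ E) (μ : E) (ℓ : ℝ)
    (R : Matrix (Fin n) (Fin n) ℝ) (c κ : Fin n → ℝ) :
    Continuous (stretchedDensity b μ ℓ R c κ) := by
  have : Continuous (rotCoord b μ R) := by
    unfold rotCoord
    fun_prop
  unfold stretchedDensity
  fun_prop

lemma stretchedDensity_nonneg (b : OrthonormalBasis (Fin n) ℝ E) (μ : E) (ℓ : ℝ)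
    (R : Matrix (Fin n) (Fin n) ℝ) (c κ : Fin n → ℝ) (y : E) :
    0 ≤ stretchedDensity b μ ℓ R c κ y := by
  unfold stretchedDensity
  positivity

lemma exp_neg_half_sum (κ z : Fin n → ℝ) :
    Real.exp (-(1 / 2) * ∑ i, κ i * z i ^ 2) = ∏ i, Real.exp (-(κ i / 2) * z i ^ 2) := by
  rw [← Real.exp_sum, Finset.mul_sum]
  congr 1
  exact Finset.sum_congr rfl fun i _ => by ring

lemma envelope_neg_one_le_one (b : OrthonormalBasis (Fin n) ℝ E) (μ : E) (ℓ : ℝ)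
    (R : Matrix (Fin n) (Fin n) ℝ) (c : Fin n → ℝ) {ε : Fin n → ℝ} (hε : ∀ i, 0 ≤ ε i) {w : ℝ}
    (hw : 0 ≤ w) (y : E) : envelope b μ ℓ R c ε w (-1) y ≤ envelope b μ ℓ R c ε w 1 y := by
  refine mul_le_mul (Real.exp_le_exp.2 (by linarith)) ?_ (stretchedDensity_nonneg _ _ _ _ _ _ _)
    (Real.exp_nonneg _)
  refine mul_le_mul_of_nonneg_left (Real.exp_le_exp.2 ?_) (by positivity)
  refine mul_le_mul_of_nonpos_left (Finset.sum_le_sum fun i _ => ?_) (by norm_num)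
  have : Real.exp (-(1 * ε i)) ≤ Real.exp (-(-1 * ε i)) :=
    Real.exp_le_exp.2 (by linarith [hε i])
  gcongr

/-- The geometric mean of the two envelopes. -/
lemma sqrt_envelope_mul (b : OrthonormalBasis (Fin n) ℝ E) (μ : E) (ℓ : ℝ)
    (R : Matrix (Fin n) (Fin n) ℝ) (c ε : Fin n → ℝ) (w : ℝ) (y : E) :
    Real.sqrt (envelope b μ ℓ R c ε w (-1) y) * Real.sqrt (envelope b μ ℓ R c ε w 1 y) =
      stretchedDensity b μ ℓ R c (fun i => Real.cosh (ε i)) y := by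
  have hnn := stretchedDensity_nonneg b μ ℓ R c
  rw [← Real.sqrt_mul (show 0 ≤ envelope b μ ℓ R c ε w (-1) y from
    mul_nonneg (Real.exp_pos _).le (hnn _ _))]
  refine (Real.sqrt_eq_iff_mul_self_eq (mul_nonneg (mul_nonneg (Real.exp_pos _).le (hnn _ _))
    (mul_nonneg (Real.exp_pos _).le (hnn _ _))) (hnn _ _)).2 ?_
  unfold stretchedDensity
  have e : ∀ A x y z u v : ℝ, x + y = 0 → u + v = z + z →
      A * Real.exp z * (A * Real.exp z) =
        Real.exp x * (A * Real.exp u) * (Real.exp y * (A * Real.exp v)) := by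
    intro A x y z u v h1 h2
    have e1 : Real.exp x * Real.exp y = 1 := by rw [← Real.exp_add, h1, Real.exp_zero]
    have e2 : Real.exp u * Real.exp v = Real.exp z * Real.exp z := by
      rw [← Real.exp_add, h2, Real.exp_add]
    linear_combination (-(A ^ 2 * Real.exp u * Real.exp v)) * e1 - A ^ 2 * e2
  refine (e _ (-1 * w) (1 * w) _ _ _ (by ring) ?_).symm
  rw [← mul_add, ← Finset.sum_add_distrib, ← mul_add, ← Finset.sum_add_distrib]
  congr 1
  refine Finset.sum_congr rfl fun i _ => ?_
  simp only [Real.cosh_eq, neg_one_mul, neg_neg, one_mul]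
  ring

variable [FiniteDimensional ℝ E] [MeasurableSpace E] [BorelSpace E]

lemma measurePreserving_rotCoord (b : OrthonormalBasis (Fin n) ℝ E) (μ : E)
    {R : Matrix (Fin n) (Fin n) ℝ} (hR : Rᵀ * R = 1) :
    MeasurePreserving (rotCoord b μ R) := by
  have h1 : MeasurePreserving (fun y : E => y - μ) := measurePreserving_sub_right volume μ
  have h2 := b.measurePreserving_repr
  have h3 := PiLp.volume_preserving_ofLp (Fin n)
  have hdet : R.det * R.det = 1 := by
    have := congrArg Matrix.det hR
    rwa [Matrix.det_mul, Matrix.det_transpose, Matrix.det_one] at this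
  have habs : |(Rᵀ.det)⁻¹| = 1 := by
    rw [Matrix.det_transpose, abs_inv, inv_eq_one]
    rcases mul_self_eq_one_iff.1 hdet with h | h <;> simp [h]
  have h4 : MeasurePreserving (Matrix.toLin' Rᵀ : (Fin n → ℝ) → (Fin n → ℝ)) := by
    refine ⟨(LinearMap.continuous_of_finiteDimensional _).measurable, ?_⟩
    rw [Real.map_matrix_volume_pi_eq_smul_volume_pi, habs]
    · simp
    · rw [Matrix.det_transpose]
      intro h
      simp [h] at hdet
  exact (h4.comp h3).comp (h2.comp h1)

lemma integrable_exp_neg_half_sum {κ : Fin n → ℝ} (hκ : ∀ i, 0 < κ i) :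
    Integrable (fun z : Fin n → ℝ => Real.exp (-(1 / 2) * ∑ i, κ i * z i ^ 2)) := by
  simp_rw [exp_neg_half_sum]
  exact Integrable.fintype_prod fun i => integrable_exp_neg_mul_sq (half_pos (hκ i))

lemma integral_exp_neg_half_sum (κ : Fin n → ℝ) :
    ∫ z : Fin n → ℝ, Real.exp (-(1 / 2) * ∑ i, κ i * z i ^ 2) =
      ∏ i, Real.sqrt (2 * Real.pi / κ i) := by
  simp_rw [exp_neg_half_sum]
  rw [integral_fintype_prod_volume_eq_prod (fun i (x : ℝ) => Real.exp (-(κ i / 2) * x ^ 2))]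
  refine Finset.prod_congr rfl fun i _ => ?_
  rw [integral_gaussian]
  congr 1
  rw [div_div_eq_mul_div, mul_comm]

lemma integrable_stretchedDensity (b : OrthonormalBasis (Fin n) ℝ E) (μ : E) (ℓ : ℝ)
    {R : Matrix (Fin n) (Fin n) ℝ} (hR : Rᵀ * R = 1) (c : Fin n → ℝ) {κ : Fin n → ℝ}
    (hκ : ∀ i, 0 < κ i) : Integrable (stretchedDensity b μ ℓ R c κ) := by
  have h := (measurePreserving_rotCoord b μ hR).integrable_comp_of_integrable
    (integrable_exp_neg_half_sum (κ := fun i => κ i * Real.exp (-(ℓ + c i)))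
      fun i => mul_pos (hκ i) (Real.exp_pos _))
  exact h.const_mul _

/-- The mass of a stretched density, for a shape of determinant one. -/
lemma integral_stretchedDensity (b : OrthonormalBasis (Fin n) ℝ E) (μ : E) (ℓ : ℝ)
    {R : Matrix (Fin n) (Fin n) ℝ} (hR : Rᵀ * R = 1) {c : Fin n → ℝ} (hc : ∑ i, c i = 0)
    {κ : Fin n → ℝ} (hκ : ∀ i, 0 < κ i) :
    ∫ y, stretchedDensity b μ ℓ R c κ y = (Real.sqrt (∏ i, κ i))⁻¹ := by
  have hmp := measurePreserving_rotCoord b μ hR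
  have h := integral_exp_neg_half_sum fun i => κ i * Real.exp (-(ℓ + c i))
  rw [← hmp.map_eq, integral_map hmp.aemeasurable
    (Continuous.aestronglyMeasurable (by fun_prop))] at h
  unfold stretchedDensity
  rw [integral_const_mul, h, ← Real.sqrt_prod _ fun i _ => by have := hκ i; positivity]
  have e : ∏ i, 2 * Real.pi / (κ i * Real.exp (-(ℓ + c i))) =
      (2 * Real.pi) ^ n * Real.exp ℓ ^ n * (∏ i, κ i)⁻¹ := by
    have : ∀ i, 2 * Real.pi / (κ i * Real.exp (-(ℓ + c i))) =
        2 * Real.pi * Real.exp ℓ * Real.exp (c i) * (κ i)⁻¹ := by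
      intro i
      rw [Real.exp_neg, Real.exp_add, mul_assoc _ (Real.exp ℓ)]
      have := (hκ i).ne'
      field_simp
    simp_rw [this]
    rw [Finset.prod_mul_distrib, Finset.prod_mul_distrib, ← Real.exp_sum, hc, Real.exp_zero,
      mul_one, Finset.prod_inv_distrib, Finset.prod_const, Finset.card_univ, Fintype.card_fin,
      mul_pow]
  rw [e, Real.sqrt_mul (x := (2 * Real.pi) ^ n * Real.exp ℓ ^ n) (by positivity),
    Real.sqrt_inv, ← mul_assoc, inv_mul_cancel₀, one_mul]
  positivity

/-- The squared Hellinger width of the pair of envelopes. -/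
lemma hellingerSq_envelope_le (b : OrthonormalBasis (Fin n) ℝ E) (μ : E) (ℓ : ℝ)
    {R : Matrix (Fin n) (Fin n) ℝ} (hR : Rᵀ * R = 1) {c : Fin n → ℝ} (hc : ∑ i, c i = 0)
    (ε : Fin n → ℝ) (w : ℝ) :
    hellingerSq (envelope b μ ℓ R c ε w (-1)) (envelope b μ ℓ R c ε w 1) ≤
      ENNReal.ofReal (2 * (Real.cosh (w + (∑ i, ε i) / 2) - 1) + (∑ i, ε i ^ 2) / 2) := by
  have hnn := stretchedDensity_nonneg b μ ℓ R c
  have henv : ∀ σ y, 0 ≤ envelope b μ ℓ R c ε w σ y := fun σ y =>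
    mul_nonneg (Real.exp_pos _).le (hnn _ _)
  have hint : ∀ σ, Integrable (envelope b μ ℓ R c ε w σ) := fun σ =>
    (integrable_stretchedDensity b μ ℓ hR c fun i => Real.exp_pos _).const_mul _
  have hmass : ∀ σ, ∫ y, envelope b μ ℓ R c ε w σ y = Real.exp (σ * (w + (∑ i, ε i) / 2)) := by
    intro σ
    unfold envelope
    rw [integral_const_mul, integral_stretchedDensity b μ ℓ hR hc fun i => Real.exp_pos _,
      ← Real.exp_sum, ← Real.exp_half, ← Real.exp_neg, ← Real.exp_add, Finset.sum_neg_distrib,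
      ← Finset.mul_sum]
    congr 1
    ring
  have hcosh := integrable_stretchedDensity b μ ℓ hR c fun i => Real.cosh_pos (ε i)
  have hexpand : ∀ y, (Real.sqrt (envelope b μ ℓ R c ε w (-1) y) -
      Real.sqrt (envelope b μ ℓ R c ε w 1 y)) ^ 2 =
      envelope b μ ℓ R c ε w (-1) y + envelope b μ ℓ R c ε w 1 y -
        2 * stretchedDensity b μ ℓ R c (fun i => Real.cosh (ε i)) y := by
    intro y
    rw [← sqrt_envelope_mul b μ ℓ R c ε w y, sub_sq, Real.sq_sqrt (henv _ _),
      Real.sq_sqrt (henv _ _)]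
    ring
  have hprod : 1 - (∑ i, ε i ^ 2) / 4 ≤ (Real.sqrt (∏ i, Real.cosh (ε i)))⁻¹ := by
    have h1 : ∏ i, Real.cosh (ε i) ≤ Real.exp ((∑ i, ε i ^ 2) / 2) := by
      rw [Finset.sum_div, Real.exp_sum]
      exact Finset.prod_le_prod (fun i _ => (Real.cosh_pos _).le)
        fun i _ => Real.cosh_le_exp_half_sq _
    have h2 : Real.sqrt (∏ i, Real.cosh (ε i)) ≤ Real.exp ((∑ i, ε i ^ 2) / 4) := by
      refine (Real.sqrt_le_sqrt h1).trans_eq ?_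
      rw [← Real.exp_half]
      congr 1
      ring
    have h3 : 0 < Real.sqrt (∏ i, Real.cosh (ε i)) :=
      Real.sqrt_pos.2 (Finset.prod_pos fun i _ => Real.cosh_pos _)
    calc 1 - (∑ i, ε i ^ 2) / 4 ≤ Real.exp (-((∑ i, ε i ^ 2) / 4)) := by
          linarith [Real.add_one_le_exp (-((∑ i, ε i ^ 2) / 4))]
      _ = (Real.exp ((∑ i, ε i ^ 2) / 4))⁻¹ := Real.exp_neg _
      _ ≤ _ := inv_anti₀ h3 h2
  unfold hellingerSq
  rw [← ofReal_integral_eq_lintegral_ofReal _ (Filter.Eventually.of_forall fun y => sq_nonneg _)]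
  · refine ENNReal.ofReal_le_ofReal ?_
    simp_rw [hexpand]
    have hadd : Integrable fun y =>
        envelope b μ ℓ R c ε w (-1) y + envelope b μ ℓ R c ε w 1 y := (hint _).add (hint _)
    rw [integral_sub hadd (hcosh.const_mul 2), integral_add (hint _) (hint _),
      integral_const_mul, integral_stretchedDensity b μ ℓ hR hc fun i => Real.cosh_pos (ε i),
      hmass, hmass, Real.cosh_eq, neg_one_mul, one_mul]
    linarith
  · simp_rw [hexpand]
    exact ((hint _).add (hint _)).sub (hcosh.const_mul 2)

end Envelope

/-! ### Gaussian densities between envelopes -/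

section Sandwich

open scoped Matrix.Norms.L2Operator

variable {E : Type*} [NormedAddCommGroup E] [InnerProductSpace ℝ E] {n : ℕ}

/-- The Gaussian density in the coordinates given by the principal axes. -/
lemma gaussDensity_eq (b : OrthonormalBasis (Fin n) ℝ E) (μ : E) {L : ℝ} (hL : 0 < L)
    {D : Matrix (Fin n) (Fin n) ℝ} (hD : Dᵀ * D = 1) {A : Fin n → ℝ} (hA : ∀ i, 0 < A i)
    (hA1 : ∏ i, A i = 1) (y : E) :
    gaussDensity b μ (L • (D * Matrix.diagonal A * Dᵀ)) y =
      (Real.sqrt ((2 * Real.pi) ^ n * L ^ n))⁻¹ *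
        Real.exp (-(1 / 2) * (L⁻¹ * ∑ i, (A i)⁻¹ * rotCoord b μ D y i ^ 2)) := by
  have hD' : D * Dᵀ = 1 := mul_eq_one_comm.1 hD
  have hdet : (L • (D * Matrix.diagonal A * Dᵀ)).det = L ^ n := by
    rw [Matrix.det_smul, Fintype.card_fin, Matrix.det_mul, Matrix.det_mul, Matrix.det_diagonal,
      hA1, mul_one, ← Matrix.det_mul, hD', Matrix.det_one, mul_one]
  have hinv : (L • (D * Matrix.diagonal A * Dᵀ))⁻¹ =
      L⁻¹ • (D * Matrix.diagonal (fun i => (A i)⁻¹) * Dᵀ) := by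
    refine Matrix.inv_eq_right_inv ?_
    have hAA : Matrix.diagonal A * Matrix.diagonal (fun i => (A i)⁻¹) = 1 := by
      rw [Matrix.diagonal_mul_diagonal, ← Matrix.diagonal_one]
      congr 1
      funext i
      exact mul_inv_cancel₀ (hA i).ne'
    rw [smul_mul_smul_comm, mul_inv_cancel₀ hL.ne', one_smul]
    calc D * Matrix.diagonal A * Dᵀ * (D * Matrix.diagonal (fun i => (A i)⁻¹) * Dᵀ)
        = D * Matrix.diagonal A * (Dᵀ * D) * Matrix.diagonal (fun i => (A i)⁻¹) * Dᵀ := by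
          simp only [mul_assoc]
      _ = 1 := by rw [hD, mul_one, mul_assoc D, hAA, mul_one, hD']
  unfold gaussDensity
  rw [hdet, hinv]
  congr 3
  rw [Matrix.smul_mulVec, dotProduct_smul, smul_eq_mul, ← Matrix.mulVec_mulVec,
    ← Matrix.mulVec_mulVec, Matrix.dotProduct_mulVec, ← Matrix.mulVec_transpose]
  congr 1
  unfold rotCoord dotProduct
  refine Finset.sum_congr rfl fun i _ => ?_
  rw [Matrix.mulVec_diagonal]
  ring

lemma sum_sq_mulVec_of_orthogonal {Q : Matrix (Fin n) (Fin n) ℝ} (hQ : Qᵀ * Q = 1)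
    (x : Fin n → ℝ) : ∑ i, (Q *ᵥ x) i ^ 2 = ∑ i, x i ^ 2 := by
  have : (Q *ᵥ x) ⬝ᵥ (Q *ᵥ x) = x ⬝ᵥ x := by
    rw [Matrix.dotProduct_mulVec, Matrix.vecMul_mulVec, ← Matrix.mulVec_transpose]
    simp [hQ]
  simpa [dotProduct, sq] using this

/-- Rotating the axes by little and moving the center by little changes the quadratic form with
eigenvalues `(A i)⁻¹` by a small factor, up to an additive constant. -/
lemma sum_inv_mul_sq_le {A : Fin n → ℝ} {lm lp η e t : ℝ} (hlm : 0 < lm)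
    (hA : ∀ i, lm ≤ A i ∧ A i ≤ lp) {P Q : Matrix (Fin n) (Fin n) ℝ} (hP : Pᵀ * P = 1)
    (hQ : Qᵀ * Q = 1) (hPQ : ‖P - Q‖ ≤ η) (he : Real.sqrt (lp / lm) * η ≤ e) (ht : 0 < t)
    (x m : Fin n → ℝ) :
    ∑ i, (A i)⁻¹ * (P *ᵥ (x + m)) i ^ 2 ≤
      (1 + t) * (1 + e) ^ 2 * ∑ i, (A i)⁻¹ * (Q *ᵥ x) i ^ 2 +
        (1 + 1 / t) * (lm⁻¹ * ∑ i, m i ^ 2) := by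
  have hA0 : ∀ i, 0 < A i := fun i => hlm.trans_le (hA i).1
  -- the norm whose square is the quadratic form
  let N : (Fin n → ℝ) → ℝ := fun u =>
    ‖(WithLp.toLp 2 (fun i => (Real.sqrt (A i))⁻¹ * u i) : EuclideanSpace ℝ (Fin n))‖
  have hN2 : ∀ u, N u ^ 2 = ∑ i, (A i)⁻¹ * u i ^ 2 := by
    intro u
    simp only [N, EuclideanSpace.real_norm_sq_eq, mul_pow, inv_pow, Real.sq_sqrt (hA0 _).le]
  have hN0 : ∀ u, 0 ≤ N u := fun u => norm_nonneg _
  have hNadd : ∀ u v, N (u + v) ≤ N u + N v := by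
    intro u v
    refine le_trans (le_of_eq ?_) (norm_add_le _ _)
    simp only [N, ← WithLp.toLp_add]
    congr 2
    funext i
    simp [mul_add]
  have hNle : ∀ u, N u ≤ (Real.sqrt lm)⁻¹ * Real.sqrt (∑ i, u i ^ 2) := by
    intro u
    rw [← Real.sqrt_inv, ← Real.sqrt_mul (by positivity)]
    refine Real.le_sqrt_of_sq_le ?_
    rw [hN2, Finset.mul_sum]
    refine Finset.sum_le_sum fun i _ => ?_
    have := inv_anti₀ hlm (hA i).1
    gcongr
  have hleN : ∀ u, Real.sqrt (∑ i, u i ^ 2) ≤ Real.sqrt lp * N u := by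
    intro u
    refine Real.sqrt_le_iff.2 ⟨by have := hN0 u; positivity, ?_⟩
    have hlp : ∀ i, 0 < A i ∧ A i ≤ lp := fun i => ⟨hA0 i, (hA i).2⟩
    rw [mul_pow, hN2]
    rcases isEmpty_or_nonempty (Fin n) with hE | ⟨⟨i₀⟩⟩
    · simp
    rw [Real.sq_sqrt ((hlp i₀).1.le.trans (hlp i₀).2), Finset.mul_sum]
    refine Finset.sum_le_sum fun i _ => ?_
    have h1 : 1 ≤ lp * (A i)⁻¹ := by
      rw [← div_eq_mul_inv, one_le_div (hA0 i)]
      exact (hA i).2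
    nlinarith [sq_nonneg (u i)]
  have hop : ∀ u, Real.sqrt (∑ i, ((P - Q) *ᵥ u) i ^ 2) ≤ η * Real.sqrt (∑ i, u i ^ 2) := by
    intro u
    have h := (Matrix.l2_opNorm_mulVec (P - Q) (WithLp.toLp 2 u)).trans
      (mul_le_mul_of_nonneg_right hPQ (norm_nonneg _))
    rw [EuclideanSpace.norm_eq, EuclideanSpace.norm_eq] at h
    simpa using h
  have hdec : P *ᵥ (x + m) = (Q *ᵥ x + (P - Q) *ᵥ x) + P *ᵥ m := by
    rw [Matrix.mulVec_add, Matrix.sub_mulVec]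
    abel
  have hη : 0 ≤ η := (norm_nonneg _).trans hPQ
  have h1 : N ((P - Q) *ᵥ x) ≤ e * N (Q *ᵥ x) := by
    calc N ((P - Q) *ᵥ x) ≤ (Real.sqrt lm)⁻¹ * (η * (Real.sqrt lp * N (Q *ᵥ x))) := by
          refine (hNle _).trans ?_
          gcongr
          refine (hop x).trans ?_
          gcongr
          rw [← sum_sq_mulVec_of_orthogonal hQ]
          exact hleN _
      _ = Real.sqrt (lp / lm) * η * N (Q *ᵥ x) := by
          rw [Real.sqrt_div' _ hlm.le]
          ring
      _ ≤ _ := mul_le_mul_of_nonneg_right he (hN0 _)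
  have h2 : N (P *ᵥ m) ≤ (Real.sqrt lm)⁻¹ * Real.sqrt (∑ i, m i ^ 2) := by
    refine (hNle _).trans_eq ?_
    rw [sum_sq_mulVec_of_orthogonal hP]
  have h3 : N (P *ᵥ (x + m)) ≤
      (1 + e) * N (Q *ᵥ x) + (Real.sqrt lm)⁻¹ * Real.sqrt (∑ i, m i ^ 2) := by
    rw [hdec]
    linarith [hNadd (Q *ᵥ x + (P - Q) *ᵥ x) (P *ᵥ m), hNadd (Q *ᵥ x) ((P - Q) *ᵥ x)]
  have hw2 : ((Real.sqrt lm)⁻¹ * Real.sqrt (∑ i, m i ^ 2)) ^ 2 = lm⁻¹ * ∑ i, m i ^ 2 := by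
    rw [mul_pow, inv_pow, Real.sq_sqrt hlm.le, Real.sq_sqrt (Finset.sum_nonneg fun i _ =>
      sq_nonneg _)]
  rw [← hN2, ← hN2, ← hw2]
  set a := (1 + e) * N (Q *ᵥ x) with ha
  set w := (Real.sqrt lm)⁻¹ * Real.sqrt (∑ i, m i ^ 2)
  have hyoung : 2 * a * w ≤ t * a ^ 2 + 1 / t * w ^ 2 := by
    have h := sq_nonneg (t * a - w)
    have e1 : t * a ^ 2 + 1 / t * w ^ 2 - 2 * a * w = (t * a - w) ^ 2 / t := by
      field_simp
      ring
    have := div_nonneg h ht.le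
    linarith
  calc N (P *ᵥ (x + m)) ^ 2 ≤ (a + w) ^ 2 := pow_le_pow_left₀ (hN0 _) h3 2
    _ ≤ (1 + t) * a ^ 2 + (1 + 1 / t) * w ^ 2 := by nlinarith
    _ = _ := by rw [ha]; ring

/-- A Gaussian density lies between the envelopes of a cell that contains its parameters. -/
lemma envelope_le_gaussDensity_le (b : OrthonormalBasis (Fin n) ℝ E) {μ μ₀ : E}
    {L ℓ r Lm lm lp η e t τ g : ℝ} {D R : Matrix (Fin n) (Fin n) ℝ} {A c h s : Fin n → ℝ}
    (hLm : 0 < Lm) (hL : Lm ≤ L) (hLr : |Real.log L - ℓ| ≤ r) (hlm : 0 < lm)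
    (hA : ∀ i, lm ≤ A i ∧ A i ≤ lp) (hA1 : ∏ i, A i = 1) (hAc : ∀ i, |Real.log (A i) - c i| ≤ h i)
    (hD : Dᵀ * D = 1) (hR : Rᵀ * R = 1) (hs : ∀ i, s i = 1 ∨ s i = -1)
    (hDR : ‖Matrix.diagonal s * Dᵀ - Rᵀ‖ ≤ η) (he : Real.sqrt (lp / lm) * η ≤ e) (ht : 0 < t)
    (hτ0 : 0 ≤ τ) (hτ : (1 + t) * (1 + e) ^ 2 ≤ Real.exp τ)
    (hg : (1 + 1 / t) * ((Lm * lm)⁻¹ * ∑ i, b.repr (μ - μ₀) i ^ 2) ≤ g) (y : E) :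
    envelope b μ₀ ℓ R c (fun i => τ + r + h i) (g / 2 + n * r / 2) (-1) y ≤
        gaussDensity b μ (L • (D * Matrix.diagonal A * Dᵀ)) y ∧
      gaussDensity b μ (L • (D * Matrix.diagonal A * Dᵀ)) y ≤
        envelope b μ₀ ℓ R c (fun i => τ + r + h i) (g / 2 + n * r / 2) 1 y := by
  have hL0 : 0 < L := hLm.trans_le hL
  have hA0 : ∀ i, 0 < A i := fun i => hlm.trans_le (hA i).1
  rw [gaussDensity_eq b μ hL0 hD hA0 hA1]
  have hss := diagonal_mul_self_of_sign hs
  have hRT : Rᵀᵀ * Rᵀ = 1 := by rw [Matrix.transpose_transpose]; exact mul_eq_one_comm.1 hR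
  have hST : (Matrix.diagonal s * Dᵀ)ᵀ * (Matrix.diagonal s * Dᵀ) = 1 := by
    rw [Matrix.transpose_mul, Matrix.transpose_transpose, Matrix.diagonal_transpose, mul_assoc,
      ← mul_assoc _ _ Dᵀ, hss, one_mul, mul_eq_one_comm.1 hD]
  set m : Fin n → ℝ := fun i => b.repr (μ - μ₀) i with hm
  set x : Fin n → ℝ := fun i => b.repr (y - μ) i with hx
  set x₀ : Fin n → ℝ := fun i => b.repr (y - μ₀) i with hx₀
  have hx1 : x + m = x₀ := by
    funext i
    simp only [hx, hm, hx₀, Pi.add_apply, ← PiLp.add_apply, ← map_add, sub_add_sub_cancel]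
  have hx2 : x₀ + -m = x := by rw [← hx1]; abel
  have hv : ∀ i, ((Matrix.diagonal s * Dᵀ) *ᵥ x) i ^ 2 = rotCoord b μ D y i ^ 2 := by
    intro i
    rw [← Matrix.mulVec_mulVec, Matrix.mulVec_diagonal, mul_pow]
    rcases hs i with h | h <;> simp [h, rotCoord, hx]
  have hz : ∀ i, (Rᵀ *ᵥ x₀) i ^ 2 = rotCoord b μ₀ R y i ^ 2 := fun i => rfl
  have hup := sum_inv_mul_sq_le hlm hA hRT hST (by rwa [norm_sub_rev]) he ht x m
  have hlo := sum_inv_mul_sq_le hlm hA hST hRT hDR he ht x₀ (-m)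
  rw [hx1] at hup
  rw [hx2] at hlo
  simp only [hv, hz, Pi.neg_apply, neg_sq] at hup hlo
  set v := ∑ i, (A i)⁻¹ * rotCoord b μ D y i ^ 2 with hv_def
  set z := ∑ i, (A i)⁻¹ * rotCoord b μ₀ R y i ^ 2 with hz_def
  have hv0 : 0 ≤ v := Finset.sum_nonneg fun i _ =>
    mul_nonneg (inv_nonneg.2 (hA0 i).le) (sq_nonneg _)
  have hz0 : 0 ≤ z := Finset.sum_nonneg fun i _ =>
    mul_nonneg (inv_nonneg.2 (hA0 i).le) (sq_nonneg _)
  have hm0 : 0 ≤ ∑ i, m i ^ 2 := Finset.sum_nonneg fun i _ => sq_nonneg _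
  have hgL : L⁻¹ * ((1 + 1 / t) * (lm⁻¹ * ∑ i, m i ^ 2)) ≤ g := by
    refine (mul_le_mul_of_nonneg_right (inv_anti₀ hLm hL) (by positivity)).trans
      (le_trans (le_of_eq ?_) hg)
    change _ = (1 + 1 / t) * ((Lm * lm)⁻¹ * ∑ i, m i ^ 2)
    rw [mul_inv]
    ring
  have hg0 : 0 ≤ g := le_trans (by positivity) hgL
  have hup' : L⁻¹ * z ≤ Real.exp τ * (L⁻¹ * v) + g := by
    calc L⁻¹ * z ≤ L⁻¹ * (Real.exp τ * v + (1 + 1 / t) * (lm⁻¹ * ∑ i, m i ^ 2)) := by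
          gcongr
          exact hup.trans (by gcongr)
      _ ≤ _ := by rw [mul_add]; linarith
  have hlo' : L⁻¹ * v ≤ Real.exp τ * (L⁻¹ * z) + g := by
    calc L⁻¹ * v ≤ L⁻¹ * (Real.exp τ * z + (1 + 1 / t) * (lm⁻¹ * ∑ i, m i ^ 2)) := by
          gcongr
          exact hlo.trans (by gcongr)
      _ ≤ _ := by rw [mul_add]; linarith
  have hLr' := abs_le.1 hLr
  have hLA : ∀ i, L⁻¹ * (A i)⁻¹ = Real.exp (-(Real.log L + Real.log (A i))) := by
    intro i
    rw [Real.exp_neg, Real.exp_add, Real.exp_log hL0, Real.exp_log (hA0 i), mul_inv]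
  -- the two quadratic forms of the envelopes
  have hqu : ∑ i, Real.exp (-(1 * (τ + r + h i))) * Real.exp (-(ℓ + c i)) *
      rotCoord b μ₀ R y i ^ 2 ≤ L⁻¹ * v + g := by
    have h1 : ∑ i, Real.exp (-(1 * (τ + r + h i))) * Real.exp (-(ℓ + c i)) *
        rotCoord b μ₀ R y i ^ 2 ≤ Real.exp (-τ) * (L⁻¹ * z) := by
      rw [hz_def, Finset.mul_sum, Finset.mul_sum]
      refine Finset.sum_le_sum fun i _ => ?_
      rw [← mul_assoc L⁻¹, ← mul_assoc, hLA, ← Real.exp_add, ← Real.exp_add]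
      refine mul_le_mul_of_nonneg_right (Real.exp_le_exp.2 ?_) (sq_nonneg _)
      have := abs_le.1 (hAc i)
      linarith
    have h2 : Real.exp (-τ) * (Real.exp τ * (L⁻¹ * v) + g) ≤ L⁻¹ * v + g := by
      rw [mul_add, ← mul_assoc, ← Real.exp_add, neg_add_cancel, Real.exp_zero, one_mul]
      have : Real.exp (-τ) ≤ 1 := Real.exp_le_one_iff.2 (by linarith)
      nlinarith
    exact h1.trans ((mul_le_mul_of_nonneg_left hup' (Real.exp_pos _).le).trans h2)
  have hql : L⁻¹ * v ≤ (∑ i, Real.exp (-(-1 * (τ + r + h i))) * Real.exp (-(ℓ + c i)) *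
      rotCoord b μ₀ R y i ^ 2) + g := by
    refine hlo'.trans (add_le_add_left ?_ _)
    rw [hz_def, Finset.mul_sum, Finset.mul_sum]
    refine Finset.sum_le_sum fun i _ => ?_
    rw [← mul_assoc L⁻¹, ← mul_assoc, hLA, ← Real.exp_add, ← Real.exp_add]
    refine mul_le_mul_of_nonneg_right (Real.exp_le_exp.2 ?_) (sq_nonneg _)
    have := abs_le.1 (hAc i)
    linarith
  -- the normalizing factors
  have hpre : ∀ l : ℝ, (Real.sqrt ((2 * Real.pi) ^ n * Real.exp l ^ n))⁻¹ =
      (Real.sqrt ((2 * Real.pi) ^ n))⁻¹ * Real.exp (-(n * l / 2)) := by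
    intro l
    rw [Real.sqrt_mul (by positivity), mul_inv, ← Real.exp_nat_mul, ← Real.exp_half,
      ← Real.exp_neg]
  have hLexp : (Real.sqrt ((2 * Real.pi) ^ n * L ^ n))⁻¹ =
      (Real.sqrt ((2 * Real.pi) ^ n))⁻¹ * Real.exp (-(n * Real.log L / 2)) := by
    rw [← hpre, Real.exp_log hL0]
  have hn : (0 : ℝ) ≤ n := n.cast_nonneg
  have hn1 := mul_le_mul_of_nonneg_left hLr'.1 hn
  have hn2 := mul_le_mul_of_nonneg_left hLr'.2 hn
  unfold envelope stretchedDensity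
  rw [hLexp, hpre]
  have hsq : 0 ≤ (Real.sqrt ((2 * Real.pi) ^ n))⁻¹ := by positivity
  have hcomb : ∀ C a b c : ℝ, Real.exp a * (C * Real.exp b * Real.exp c) =
      C * Real.exp (a + b + c) := by
    intro C a b c
    rw [Real.exp_add, Real.exp_add]
    ring
  constructor
  · rw [hcomb, mul_assoc, ← Real.exp_add]
    exact mul_le_mul_of_nonneg_left (Real.exp_le_exp.2 (by linarith)) hsq
  · rw [hcomb, mul_assoc, ← Real.exp_add]
    exact mul_le_mul_of_nonneg_left (Real.exp_le_exp.2 (by linarith)) hsq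

end Sandwich

/-! ### Nets for the four quantities -/

section Nets

open scoped Matrix.Norms.L2Operator

/-- An interval of length `len` is covered by one interval of length `s`, or, if `len > s`, by less
than `len / s + 1` of them. -/
lemma exists_interval_net (lo : ℝ) {len s : ℝ} (hs : 0 < s) :
    ∃ T : Finset ℝ, (∀ y, lo ≤ y → y ≤ lo + len → ∃ c ∈ T, |y - c| ≤ s / 2) ∧
      ((T.card : ℝ) ≤ 1 ∨ 1 < len / s ∧ (T.card : ℝ) ≤ len / s + 1) := by
  rcases le_or_gt len s with hle | hlt
  · refine ⟨{lo + len / 2}, fun y h1 h2 => ⟨_, Finset.mem_singleton_self _, ?_⟩, Or.inl (by simp)⟩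
    rw [abs_le]
    constructor <;> linarith
  · have hx : 1 < len / s := (one_lt_div hs).2 hlt
    refine ⟨(Finset.range ⌈len / s⌉₊).image fun k : ℕ => lo + k * s + s / 2, ?_, Or.inr ⟨hx, ?_⟩⟩
    · intro y h1 h2
      have hdiv : (y - lo) / s ≤ len / s := by gcongr; linarith
      have hceil : ⌈(y - lo) / s⌉₊ ≤ ⌈len / s⌉₊ := Nat.ceil_le_ceil hdiv
      have hpos : 0 < ⌈len / s⌉₊ := Nat.ceil_pos.2 (by linarith)
      refine ⟨_, Finset.mem_image_of_mem _
        (Finset.mem_range.2 (show ⌈(y - lo) / s⌉₊ - 1 < ⌈len / s⌉₊ by omega)), ?_⟩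
      rcases h1.eq_or_lt with rfl | h1
      · simp only [sub_self, zero_div, Nat.ceil_zero, Nat.zero_sub, Nat.cast_zero, zero_mul,
          add_zero, sub_add_cancel_left, abs_neg]
        rw [abs_of_pos (half_pos hs)]
      · have hq : 0 < (y - lo) / s := div_pos (by linarith) hs
        have hc := Nat.ceil_pos.2 hq
        have hlt := Nat.ceil_lt_add_one hq.le
        have hge := Nat.le_ceil ((y - lo) / s)
        rw [Nat.cast_sub hc, Nat.cast_one]
        rw [div_le_iff₀ hs] at hge
        rw [← sub_lt_iff_lt_add, lt_div_iff₀ hs] at hlt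
        rw [abs_le]
        constructor <;> linarith
    · have h1 := (Nat.ceil_lt_add_one (a := len / s) (by linarith)).le
      refine le_trans ?_ h1
      exact_mod_cast Finset.card_image_le.trans (Finset.card_range _).le

/-- A step larger than `δ len / R` by the factor `κ ≥ 1.3` absorbs the rounding to an integer when
`δ` lies between `1` and `√2`. -/
lemma card_le_one_add_div {N x κ δ R : ℝ} (hδ : 0 < δ) (hδ2 : δ ≤ Real.sqrt 2)
    (hN : N ≤ 1 ∨ 1 < x ∧ N ≤ x + 1) (hκ : 13 / 10 ≤ κ) (hR : R = κ * x * δ) (hδR : δ ≤ 1 + R) :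
    N ≤ (1 + R) / δ := by
  rw [le_div_iff₀ hδ]
  rcases hN with h | ⟨h1, h2⟩
  · nlinarith
  · have hs : Real.sqrt 2 ≤ 10 / 7 := by
      rw [Real.sqrt_le_left (by norm_num)]
      norm_num
    have h3 : N * δ ≤ (x + 1) * δ := mul_le_mul_of_nonneg_right h2 hδ.le
    have h4 : 13 / 10 * (x * δ) ≤ κ * (x * δ) :=
      mul_le_mul_of_nonneg_right hκ (by positivity)
    have h5 : δ ≤ x * δ := le_mul_of_one_le_left hδ.le h1.le
    rw [hR, mul_assoc]
    linarith

/-- From a net for the values of one quantity to a net for the `K`-tuples of a given status. -/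
lemma Status.exists_net {X Y : Type*} {K : ℕ} (hK : 1 ≤ K) (m : Status) (v₀ : Fin K → X)
    {S : Set X} {cov : Y → X → Prop} {T : Finset Y} (hT : ∀ x ∈ S, ∃ y ∈ T, cov y x) {lg : ℝ}
    (hcard : m ≠ Status.known → (T.card : ℝ) ≤ Real.exp lg) :
    ∃ J : Finset (Fin K → Y), (J.card : ℝ) ≤ Real.exp (m.coeff K * lg) ∧
      ∀ v : Fin K → X, m.Holds v₀ v → (∀ k, v k ∈ S) → ∃ t ∈ J, ∀ k, cov (t k) (v k) := by
  classical
  cases m with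
  | known =>
    by_cases h : ∀ k, v₀ k ∈ S
    · choose t ht using fun k => hT (v₀ k) (h k)
      refine ⟨{t}, by simp [Status.coeff], ?_⟩
      rintro v rfl -
      exact ⟨t, Finset.mem_singleton_self _, fun k => (ht k).2⟩
    · refine ⟨∅, by simp [Real.exp_nonneg], ?_⟩
      rintro v rfl hv
      exact absurd hv h
  | common =>
    refine ⟨T.image fun y _ => y, ?_, fun v hv hvS => ?_⟩
    · refine le_trans ?_ ((hcard (by simp)).trans_eq ?_)
      · exact_mod_cast Finset.card_image_le
      · simp [Status.coeff]
    · obtain ⟨y, hy, hc⟩ := hT (v ⟨0, hK⟩) (hvS _)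
      exact ⟨_, Finset.mem_image_of_mem _ hy, fun k => hv ⟨0, hK⟩ k ▸ hc⟩
  | free =>
    refine ⟨Fintype.piFinset fun _ => T, ?_, fun v _ hvS => ?_⟩
    · rw [Fintype.card_piFinset, Finset.prod_const, Finset.card_univ, Fintype.card_fin]
      push_cast
      simp only [Status.coeff]
      rw [Real.exp_nat_mul]
      exact pow_le_pow_left₀ (by positivity) (hcard (by simp)) K
    · choose t ht using fun k => hT (v k) (hvS k)
      exact ⟨t, Fintype.mem_piFinset.2 fun k => (ht k).1, fun k => (ht k).2⟩

variable {E : Type*} [NormedAddCommGroup E] [InnerProductSpace ℝ E] {n : ℕ}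

lemma exists_mean_net (b : OrthonormalBasis (Fin n) ℝ E) {a hw : ℝ} (hhw : 0 < hw) {M : ℝ}
    (hM : ∀ N : ℝ, (N ≤ 1 ∨ 1 < a / hw ∧ N ≤ a / hw + 1) → N ≤ M) :
    ∃ T : Finset E, (∀ x ∈ {x : E | ∀ i, |b.repr x i| ≤ a}, ∃ y ∈ T,
        ∀ i, |b.repr (x - y) i| ≤ hw) ∧ (T.card : ℝ) ≤ M ^ n := by
  classical
  obtain ⟨T, hT, hcard⟩ := exists_interval_net (-a) (len := 2 * a) (s := 2 * hw) (by positivity)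
  rw [mul_div_mul_left _ _ two_ne_zero] at hcard
  refine ⟨(Fintype.piFinset fun _ : Fin n => T).image fun u => b.repr.symm (WithLp.toLp 2 u),
    fun x hx => ?_, ?_⟩
  · choose u hu using fun i => hT (b.repr x i) (abs_le.1 (hx i)).1
      (by linarith [(abs_le.1 (hx i)).2])
    refine ⟨_, Finset.mem_image_of_mem _ (Fintype.mem_piFinset.2 fun i => (hu i).1), fun i => ?_⟩
    rw [map_sub, LinearIsometryEquiv.apply_symm_apply]
    have := (hu i).2
    rwa [mul_div_cancel_left₀ _ two_ne_zero] at this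
  · calc _ ≤ ((Fintype.piFinset fun _ : Fin n => T).card : ℝ) := by
          exact_mod_cast Finset.card_image_le
      _ = (T.card : ℝ) ^ n := by simp
      _ ≤ M ^ n := pow_le_pow_left₀ (by positivity) (hM _ hcard) n

lemma exists_volume_net {Lm Lp r : ℝ} (hr : 0 < r) (hLm : 0 < Lm) (hL : Lm ≤ Lp) {M : ℝ}
    (hM : ∀ N : ℝ, (N ≤ 1 ∨ 1 < Real.log (Lp / Lm) / (2 * r) ∧
      N ≤ Real.log (Lp / Lm) / (2 * r) + 1) → N ≤ M) :
    ∃ T : Finset ℝ, (∀ x ∈ Set.Icc Lm Lp, ∃ y ∈ T, |Real.log x - y| ≤ r) ∧ (T.card : ℝ) ≤ M := by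
  obtain ⟨T, hT, hcard⟩ := exists_interval_net (Real.log Lm) (len := Real.log (Lp / Lm))
    (s := 2 * r) (by positivity)
  refine ⟨T, fun x hx => ?_, hM _ hcard⟩
  obtain ⟨y, hy, h⟩ := hT (Real.log x) (Real.log_le_log hLm hx.1) (by
    rw [Real.log_div (hLm.trans_le hL).ne' hLm.ne', add_sub_cancel]
    exact Real.log_le_log (hLm.trans_le hx.1) hx.2)
  rw [mul_div_cancel_left₀ _ two_ne_zero] at h
  exact ⟨y, hy, h⟩

/-- The half-widths of the cells for the logarithms of the normalized eigenvalues: the coordinate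
`0` is determined by the others, so that its error is at most the sum of the others. -/
noncomputable def shapeHalfWidth (k : ℕ) (s : ℝ) : Fin (k + 1) → ℝ :=
  Fin.cons (k * (s / 2)) fun _ => s / 2

lemma sum_shapeHalfWidth (k : ℕ) (s : ℝ) : ∑ i, shapeHalfWidth k s i = k * s := by
  simp only [shapeHalfWidth, Fin.sum_univ_succ, Fin.cons_zero, Fin.cons_succ, Finset.sum_const,
    Finset.card_univ, Fintype.card_fin, nsmul_eq_mul]
  ring

lemma shapeHalfWidth_nonneg (k : ℕ) {s : ℝ} (hs : 0 ≤ s) (i : Fin (k + 1)) :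
    0 ≤ shapeHalfWidth k s i := by
  refine Fin.cases ?_ (fun i => ?_) i
  · simp only [shapeHalfWidth, Fin.cons_zero]; positivity
  · simp only [shapeHalfWidth, Fin.cons_succ]; positivity

lemma exists_shape_net {k : ℕ} {lm lp s : ℝ} (hs : 0 < s) (hlm : 0 < lm) (hl : lm ≤ lp) {M : ℝ}
    (hM : Real.log (lp / lm) / s + 1 ≤ M) :
    ∃ T : Finset {c : Fin (k + 1) → ℝ // ∑ i, c i = 0},
      (∀ A ∈ shapeSet lm lp (k + 1), ∃ c ∈ T,
        ∀ i, |Real.log (A i) - c.1 i| ≤ shapeHalfWidth k s i) ∧ (T.card : ℝ) ≤ M ^ k := by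
  classical
  obtain ⟨T, hT, hcard⟩ := exists_interval_net (Real.log lm) (len := Real.log (lp / lm)) hs
  have hlog : 0 ≤ Real.log (lp / lm) := Real.log_nonneg ((one_le_div hlm).2 hl)
  have hcard' : (T.card : ℝ) ≤ M := by
    rcases hcard with h | h
    · have : 0 ≤ Real.log (lp / lm) / s := by positivity
      linarith
    · exact h.2.trans hM
  refine ⟨(Fintype.piFinset fun _ : Fin k => T).image fun u =>
    ⟨Fin.cons (-∑ i, u i) u, by simp [Fin.sum_univ_succ]⟩, fun A hA => ?_, ?_⟩
  · have hpos : ∀ i, 0 < A i := fun i => hlm.trans_le (hA.2 i).1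
    choose u hu using fun i : Fin k => hT (Real.log (A i.succ)) (Real.log_le_log hlm (hA.2 _).1)
      (by rw [Real.log_div (hlm.trans_le hl).ne' hlm.ne', add_sub_cancel]
          exact Real.log_le_log (hpos _) (hA.2 _).2)
    refine ⟨_, Finset.mem_image_of_mem _ (Fintype.mem_piFinset.2 fun i => (hu i).1), ?_⟩
    have hsum : Real.log (A 0) = -∑ i : Fin k, Real.log (A i.succ) := by
      have h := congrArg Real.log hA.1
      rw [Real.log_one, Real.log_prod fun i _ => (hpos i).ne', Fin.sum_univ_succ] at h
      linarith
    refine Fin.cases ?_ fun i => ?_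
    · simp only [shapeHalfWidth, Fin.cons_zero]
      rw [hsum, neg_sub_neg, abs_sub_comm, ← Finset.sum_sub_distrib]
      refine (Finset.abs_sum_le_sum_abs _ _).trans ?_
      refine (Finset.sum_le_sum fun i _ => (hu i).2).trans ?_
      simp
    · simpa [shapeHalfWidth] using (hu i).2
  · calc _ ≤ ((Fintype.piFinset fun _ : Fin k => T).card : ℝ) := by
          exact_mod_cast Finset.card_image_le
      _ = (T.card : ℝ) ^ k := by simp
      _ ≤ M ^ k := pow_le_pow_left₀ (by positivity) hcard' k

lemma exists_rotation_net (n : ℕ) {η : ℝ} (hη : 0 < η) {M : ℝ} (hM : 1 + 8 / η ≤ M) :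
    ∃ T : Finset {R : Matrix (Fin n) (Fin n) ℝ // Rᵀ * R = 1},
      (∀ D ∈ (Matrix.specialOrthogonalGroup (Fin n) ℝ : Set (Matrix (Fin n) (Fin n) ℝ)),
        ∃ R ∈ T, ∃ s : Fin n → ℝ, (∀ i, s i = 1 ∨ s i = -1) ∧
          ‖Matrix.diagonal s * Dᵀ - R.1ᵀ‖ ≤ η) ∧
      (T.card : ℝ) ≤ M ^ (n * (n - 1) / 2) := by
  classical
  obtain ⟨T, hT1, hT2, hT3⟩ := exists_orthogonal_net n hη
  refine ⟨T.subtype fun R => Rᵀ * R = 1, fun D hD => ?_, ?_⟩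
  · have hD' : Dᵀ * D = 1 := (Matrix.mem_orthogonalGroup_iff' _ _).1
      (Matrix.mem_specialOrthogonalGroup_iff.1 hD).1
    obtain ⟨R, hR, h⟩ := hT2 D hD'
    exact ⟨⟨R, hT1 R hR⟩, Finset.mem_subtype.2 hR, h⟩
  · rw [Finset.card_subtype]
    refine le_trans ?_ (hT3.trans (pow_le_pow_left₀ (by positivity) hM _))
    exact_mod_cast Finset.card_filter_le _ _

end Nets

/-! ### Bracketing entropy and the size of the cells -/

section Width

open scoped Matrix.Norms.L2Operator

section Entropy

variable {X : Type*} [MeasureSpace X] {K : ℕ}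

/-- A finite family of brackets, indexed by a finset, bounds the bracketing entropy. -/
lemma bracketingEntropy_le_of_finset {δ V : ℝ} {G : Set (Fin K → X → ℝ)} {ι : Type*}
    (J : Finset ι) (hJ : (J.card : ℝ) ≤ Real.exp V) (l u : ι → Fin K → X → ℝ)
    (hb : ∀ j ∈ J, IsBracket (l j) (u j) ∧ dMax (l j) (u j) < ENNReal.ofReal δ)
    (hG : ∀ s ∈ G, ∃ j ∈ J, ∀ k y, l j k y ≤ s k y ∧ s k y ≤ u j k y) :
    bracketingEntropy δ G ≤ (V : EReal) := by
  have hcov : CoveredByBrackets δ G J.card := by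
    refine ⟨fun i => l (J.equivFin.symm i), fun i => u (J.equivFin.symm i),
      fun i => hb _ (J.equivFin.symm i).2, fun s hs => ?_⟩
    obtain ⟨j, hj, h⟩ := hG s hs
    exact ⟨J.equivFin ⟨j, hj⟩, by simpa using h⟩
  have h1 : bracketingNumber δ G ≤ (J.card : ℕ∞) := iInf₂_le _ hcov
  have h2 : ((bracketingNumber δ G : ℕ∞) : ℝ≥0∞) ≤ ENNReal.ofReal (Real.exp V) := by
    calc ((bracketingNumber δ G : ℕ∞) : ℝ≥0∞) ≤ ((J.card : ℕ∞) : ℝ≥0∞) := by exact_mod_cast h1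
      _ = ENNReal.ofReal (J.card : ℝ) := by simp
      _ ≤ _ := ENNReal.ofReal_le_ofReal hJ
  unfold bracketingEntropy
  calc _ ≤ ENNReal.log (ENNReal.ofReal (Real.exp V)) := ENNReal.log_monotone h2
    _ = (V : EReal) := by
        rw [ENNReal.log_ofReal_of_pos (Real.exp_pos _), Real.log_exp]

lemma bracketingEntropy_antitone {δ δ' : ℝ} (h : δ ≤ δ') (G : Set (Fin K → X → ℝ)) :
    bracketingEntropy δ' G ≤ bracketingEntropy δ G := by
  have h1 : bracketingNumber δ' G ≤ bracketingNumber δ G := by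
    refine le_iInf₂ fun N hN => iInf₂_le N ?_
    obtain ⟨l, u, hb, hG⟩ := hN
    exact ⟨l, u, fun j => ⟨(hb j).1, (hb j).2.trans_le (ENNReal.ofReal_le_ofReal h)⟩, hG⟩
  exact ENNReal.log_monotone (by exact_mod_cast h1)

lemma dMax_lt_ofReal {s t : Fin K → X → ℝ} {w δ : ℝ} (hw : 0 ≤ w) (hwδ : w < δ)
    (h : ∀ k, hellingerSq (s k) (t k) ≤ ENNReal.ofReal (w ^ 2)) :
    dMax s t < ENNReal.ofReal δ := by
  refine lt_of_le_of_lt ?_ ((ENNReal.ofReal_lt_ofReal_iff (hw.trans_lt hwδ)).2 hwδ)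
  unfold dMax
  calc _ ≤ (ENNReal.ofReal (w ^ 2)) ^ (1 / 2 : ℝ) :=
        ENNReal.rpow_le_rpow (iSup_le h) (by norm_num)
    _ = ENNReal.ofReal w := by
        rw [ENNReal.ofReal_rpow_of_nonneg (sq_nonneg w) (by norm_num), ← Real.sqrt_eq_rpow,
          Real.sqrt_sq hw]

end Entropy

lemma two_mul_cosh_sub_one_add_le {δ U Q : ℝ} (hδ : 0 < δ) (hδ2 : δ ≤ Real.sqrt 2) (hU0 : 0 ≤ U)
    (hU : U ≤ δ / 15) (hQ : Q ≤ (98 / 1000 * δ) ^ 2) :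
    2 * (Real.cosh U - 1) + Q / 2 ≤ (δ / 10) ^ 2 := by
  have hδsq : δ ^ 2 ≤ 2 := by
    have := pow_le_pow_left₀ hδ.le hδ2 2
    rwa [Real.sq_sqrt zero_le_two] at this
  have hx : U ^ 2 / 2 ≤ δ ^ 2 / 450 := by
    have := pow_le_pow_left₀ hU0 hU 2
    nlinarith
  have hx0 : 0 ≤ U ^ 2 / 2 := by positivity
  have h1 := Real.cosh_le_exp_half_sq U
  have h2 := (abs_le.1 (Real.abs_exp_sub_one_sub_id_le (x := U ^ 2 / 2) (by
    rw [abs_of_nonneg hx0]; linarith))).2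
  have h3 : (U ^ 2 / 2) ^ 2 ≤ U ^ 2 / 2 * (1 / 225) := by
    rw [sq]
    exact mul_le_mul_of_nonneg_left (by linarith) hx0
  nlinarith

variable {E : Type*} [NormedAddCommGroup E] [InnerProductSpace ℝ E]

/-- The sizes of the cells of the final covering are compatible with the requirements of
`envelope_le_gaussDensity_le`. -/
lemma envelope_cell_le_gaussDensity_le {k : ℕ} (b : OrthonormalBasis (Fin (k + 1)) ℝ E) {μ μ₀ : E}
    {L ℓ Lm lm lp δ ρ n : ℝ} {D R : Matrix (Fin (k + 1)) (Fin (k + 1)) ℝ}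
    {A c s : Fin (k + 1) → ℝ} (hδ : 0 < δ) (hδ2 : δ ≤ Real.sqrt 2) (hρ : ρ = lp / lm)
    (hn : n = k + 1) (hLm : 0 < Lm) (hL : Lm ≤ L) (hLr : |Real.log L - ℓ| ≤ δ / (60 * n))
    (hlm : 0 < lm) (hl : lm ≤ lp)
    (hA : A ∈ shapeSet lm lp (k + 1))
    (hAc : ∀ i, |Real.log (A i) - c i| ≤ shapeHalfWidth k (δ / (255 * ρ * n)) i)
    (hD : Dᵀ * D = 1) (hR : Rᵀ * R = 1) (hs : ∀ i, s i = 1 ∨ s i = -1)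
    (hDR : ‖Matrix.diagonal s * Dᵀ - Rᵀ‖ ≤ δ / (31 * n * ρ))
    (hμ : ∀ i, |b.repr (μ - μ₀) i| ≤ δ * Real.sqrt (Lm * lm * (lm / lp)) / (83 * n)) (y : E) :
    envelope b μ₀ ℓ R c (fun i => δ / (13 * n) + δ / (60 * n) +
        shapeHalfWidth k (δ / (255 * ρ * n)) i)
        (δ / 80 / 2 + (k + 1 : ℕ) * (δ / (60 * n)) / 2) (-1) y ≤
        gaussDensity b μ (L • (D * Matrix.diagonal A * Dᵀ)) y ∧
      gaussDensity b μ (L • (D * Matrix.diagonal A * Dᵀ)) y ≤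
      envelope b μ₀ ℓ R c (fun i => δ / (13 * n) + δ / (60 * n) +
        shapeHalfWidth k (δ / (255 * ρ * n)) i)
        (δ / 80 / 2 + (k + 1 : ℕ) * (δ / (60 * n)) / 2) 1 y := by
  have hk : (0 : ℝ) ≤ k := k.cast_nonneg
  have hn1 : 1 ≤ n := by linarith
  have hn0 : 0 < n := by linarith
  have hlp : 0 < lp := hlm.trans_le hl
  have hρ1 : 1 ≤ ρ := by rw [hρ]; exact (one_le_div hlm).2 hl
  have hsqrt : Real.sqrt ρ ≤ ρ := by
    rw [Real.sqrt_le_left (by linarith)]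
    nlinarith
  have he : Real.sqrt (lp / lm) * (δ / (31 * n * ρ)) ≤ δ / (31 * n) := by
    rw [← hρ]
    calc _ ≤ ρ * (δ / (31 * n * ρ)) := by gcongr
      _ = _ := by field_simp
  have hδ15 : δ ≤ 3 / 2 := hδ2.trans (by
    rw [Real.sqrt_le_left (by norm_num)]
    norm_num)
  refine envelope_le_gaussDensity_le (t := δ / (83 * n)) b hLm hL hLr hlm hA.2 hA.1 hAc hD hR hs
    hDR he (by positivity) (by positivity) ?_ ?_ y
  · calc (1 + δ / (83 * n)) * (1 + δ / (31 * n)) ^ 2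
        ≤ Real.exp (δ / (83 * n)) * Real.exp (δ / (31 * n)) ^ 2 := by
          gcongr
          · linarith [Real.add_one_le_exp (δ / (83 * n))]
          · linarith [Real.add_one_le_exp (δ / (31 * n))]
      _ = Real.exp (δ / (83 * n) + 2 * (δ / (31 * n))) := by
          rw [Real.exp_add, two_mul, Real.exp_add, sq]
      _ ≤ _ := Real.exp_le_exp.2 (by
          have e : ∀ a : ℝ, δ / (a * n) = δ / n / a := fun a => by
            rw [div_div, mul_comm]
          have : 0 < δ / n := by positivity
          rw [e, e, e]
          linarith)
  · set σ := Real.sqrt (Lm * lm * (lm / lp)) with hσ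
    have hσ2 : σ ^ 2 = Lm * lm * (lm / lp) := Real.sq_sqrt (by positivity)
    have hσ1 : (Lm * lm)⁻¹ * σ ^ 2 ≤ 1 := by
      rw [hσ2, ← mul_assoc, inv_mul_cancel₀ (by positivity), one_mul, div_le_one hlp]
      exact hl
    have hsum : ∑ i, b.repr (μ - μ₀) i ^ 2 ≤ n * (δ * σ / (83 * n)) ^ 2 := by
      calc _ ≤ ∑ _i : Fin (k + 1), (δ * σ / (83 * n)) ^ 2 :=
            Finset.sum_le_sum fun i _ => sq_le_sq.2 ((hμ i).trans (le_abs_self _))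
        _ = _ := by simp [hn]
    calc (1 + 1 / (δ / (83 * n))) * ((Lm * lm)⁻¹ * ∑ i, b.repr (μ - μ₀) i ^ 2)
        ≤ (1 + 1 / (δ / (83 * n))) * ((Lm * lm)⁻¹ * (n * (δ * σ / (83 * n)) ^ 2)) := by gcongr
      _ = (1 + 1 / (δ / (83 * n))) * (δ ^ 2 / (83 ^ 2 * n)) * ((Lm * lm)⁻¹ * σ ^ 2) := by
          field_simp
      _ ≤ (1 + 1 / (δ / (83 * n))) * (δ ^ 2 / (83 ^ 2 * n)) * 1 := by gcongr
      _ = δ / n * (δ / 83 ^ 2) + δ / 83 := by field_simp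
      _ ≤ δ / 1 * (δ / 83 ^ 2) + δ / 83 := by gcongr
      _ ≤ δ / 80 := by nlinarith

variable [FiniteDimensional ℝ E] [MeasurableSpace E] [BorelSpace E]

/-- The width of the brackets is at most `δ / 10`. In the argument of the hyperbolic cosine the
additive errors of the means contribute `δ / 160`, the volumes `δ / 60`, the rotations together with
the multiplicative errors of the means `δ / 26`, and the shapes at most `δ / 510`. -/
lemma hellingerSq_envelope_cell_le {k : ℕ} (b : OrthonormalBasis (Fin (k + 1)) ℝ E) (μ : E) (ℓ : ℝ)
    {R : Matrix (Fin (k + 1)) (Fin (k + 1)) ℝ} (hR : Rᵀ * R = 1) {c : Fin (k + 1) → ℝ}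
    (hc : ∑ i, c i = 0) {δ ρ : ℝ} (hδ : 0 < δ) (hδ2 : δ ≤ Real.sqrt 2) (hρ : 1 ≤ ρ) {n : ℝ}
    (hn : n = k + 1) :
    hellingerSq
      (envelope b μ ℓ R c (fun i => δ / (13 * n) + δ / (60 * n) +
        shapeHalfWidth k (δ / (255 * ρ * n)) i)
        (δ / 80 / 2 + (k + 1 : ℕ) * (δ / (60 * n)) / 2) (-1))
      (envelope b μ ℓ R c (fun i => δ / (13 * n) + δ / (60 * n) +
        shapeHalfWidth k (δ / (255 * ρ * n)) i)
        (δ / 80 / 2 + (k + 1 : ℕ) * (δ / (60 * n)) / 2) 1)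
      ≤ ENNReal.ofReal ((δ / 10) ^ 2) := by
  have hk : (0 : ℝ) ≤ k := k.cast_nonneg
  have hn0 : 0 < n := by linarith
  refine (hellingerSq_envelope_le b μ ℓ hR hc _ _).trans (ENNReal.ofReal_le_ofReal ?_)
  set ε : Fin (k + 1) → ℝ := fun i => δ / (13 * n) + δ / (60 * n) +
    shapeHalfWidth k (δ / (255 * ρ * n)) i with hε
  have hs0 : 0 < δ / (255 * ρ * n) := by positivity
  have hε0 : ∀ i, 0 ≤ ε i := fun i => by
    have := shapeHalfWidth_nonneg k hs0.le i
    positivity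
  have hks : k * (δ / (255 * ρ * n)) ≤ δ / 255 := by
    have h1 : k * (δ / (255 * ρ * n)) ≤ n * (δ / (255 * 1 * n)) := by
      gcongr
      linarith
    refine h1.trans_eq ?_
    field_simp
  have hsum : ∑ i, ε i = δ / 13 + δ / 60 + k * (δ / (255 * ρ * n)) := by
    simp only [hε, Finset.sum_add_distrib, sum_shapeHalfWidth, Finset.sum_const, Finset.card_univ,
      Fintype.card_fin, nsmul_eq_mul, Nat.cast_add, Nat.cast_one, ← hn]
    field_simp
  have hr : ((k + 1 : ℕ) : ℝ) * (δ / (60 * n)) = δ / 60 := by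
    push_cast
    rw [← hn]
    field_simp
  have hks0 : 0 ≤ k * (δ / (255 * ρ * n)) := by positivity
  refine two_mul_cosh_sub_one_add_le hδ hδ2 ?_ ?_ ?_
  · rw [hsum, hr]; positivity
  · rw [hsum, hr]; linarith
  · refine (Finset.sum_sq_le_sq_sum_of_nonneg fun i _ => hε0 i).trans ?_
    refine pow_le_pow_left₀ (Finset.sum_nonneg fun i _ => hε0 i) ?_ 2
    rw [hsum]
    linarith

end Width

/-! ### The entropy bound -/

section EntropyBound

open scoped Matrix.Norms.L2Operator

lemma ratioMu_nonneg {B : Bounds} (ha : 0 ≤ B.a) (n : ℕ) : 0 ≤ ratioMu B n := by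
  unfold ratioMu
  positivity

lemma ratioL_nonneg {B : Bounds} (hLm : 0 < B.Lm) (hL : B.Lm ≤ B.Lp) (n : ℕ) :
    0 ≤ ratioL B n := by
  have := Real.log_nonneg ((one_le_div hLm).2 hL)
  unfold ratioL
  positivity

lemma pow_div_eq_exp {x δ : ℝ} (hx : 0 < x) (hδ : 0 < δ) (d : ℕ) :
    (x / δ) ^ d = Real.exp (d * Real.log x + d * Real.log (1 / δ)) := by
  rw [← mul_add, ← Real.log_mul hx.ne' (by positivity), mul_one_div, Real.exp_nat_mul,
    Real.exp_log (by positivity)]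

variable {E : Type*} [NormedAddCommGroup E] [InnerProductSpace ℝ E] [FiniteDimensional ℝ E]
  [MeasurableSpace E] [BorelSpace E] {n K : ℕ}

/-- The entropy bound under the restriction on `δ`, with the constant `c_S = 1`. With `ρ = λ₊ / λ₋`
and `σ = √(L₋ λ₋ / ρ)`, the cells have the half-widths `δ σ / (83 n)` for the coordinates of the
means and `δ / (60 n)` for the logarithms of the volumes, radius `δ / (31 n ρ)` for the rotations
and width `δ / (255 ρ n)` for the logarithms of the normalized eigenvalues. -/
lemma bracketingEntropy_gaussFamily_le (b : OrthonormalBasis (Fin n) ℝ E) (B : Bounds)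
    (m : ModelType) (θ₀ : Params E K n) (hn : 1 ≤ n) (hK : 1 ≤ K) (ha : 0 ≤ B.a) (hLm : 0 < B.Lm)
    (hL : B.Lm ≤ B.Lp) (hlm : 0 < B.lm) (hl : B.lm ≤ B.lp) {δ : ℝ} (hδ : 0 < δ)
    (hδ2 : δ ≤ Real.sqrt 2) (hmu : m.mu ≠ Status.known → δ ≤ 1 + ratioMu B n)
    (hvol : m.L ≠ Status.known → δ ≤ 1 + ratioL B n) :
    bracketingEntropy (δ / 9) (gaussFamily b m B θ₀) ≤
      ((volTotal 1 m B K n + dimTotal m K n * Real.log (1 / δ) : ℝ) : EReal) := by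
  obtain ⟨k, rfl⟩ : ∃ k, n = k + 1 := ⟨n - 1, by omega⟩
  set n' : ℝ := k + 1 with hn'
  have hncast : ((k + 1 : ℕ) : ℝ) = n' := by push_cast; rfl
  have hk : (0 : ℝ) ≤ k := k.cast_nonneg
  have hn1 : 1 ≤ n' := by linarith
  have hn0 : 0 < n' := by linarith
  set ρ := B.lp / B.lm with hρ
  have hlp : 0 < B.lp := hlm.trans_le hl
  have hρ1 : 1 ≤ ρ := (one_le_div hlm).2 hl
  have hρ0 : 0 < ρ := by linarith
  have hδ15 : δ ≤ 3 / 2 := hδ2.trans (by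
    rw [Real.sqrt_le_left (by norm_num)]
    norm_num)
  set σ := Real.sqrt (B.Lm * B.lm * (B.lm / B.lp)) with hσ
  have hσ0 : 0 < σ := Real.sqrt_pos.2 (by positivity)
  have hlogρ : 0 ≤ Real.log ρ := Real.log_nonneg hρ1
  -- a net for each of the four quantities; the restriction on `δ`, which bounds the number of cells
  -- for the means and the volumes, is available only if they are not known
  obtain ⟨Tμ, hTμ, cTμ⟩ : ∃ T : Finset E, (∀ x ∈ {x : E | ∀ i, |b.repr x i| ≤ B.a}, ∃ y ∈ T,
      ∀ i, |b.repr (x - y) i| ≤ δ * σ / (83 * n')) ∧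
      (m.mu ≠ Status.known → (T.card : ℝ) ≤
        Real.exp (volMu B (k + 1) + n' * Real.log (1 / δ))) := by
    by_cases hm : m.mu = Status.known
    · obtain ⟨T, hT, -⟩ := exists_mean_net b (a := B.a)
        (show 0 < δ * σ / (83 * n') by positivity) fun N hN => show N ≤ _ from
          hN.elim (fun h => h.trans (le_max_left 1 (B.a / (δ * σ / (83 * n')) + 1)))
            fun h => h.2.trans (le_max_right _ _)
      exact ⟨T, hT, fun h => absurd hm h⟩
    · obtain ⟨T, hT, hc⟩ := exists_mean_net b (a := B.a)
        (show 0 < δ * σ / (83 * n') by positivity) (M := (1 + ratioMu B (k + 1)) / δ) fun N hN =>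
          card_le_one_add_div (κ := 108 / 83) hδ hδ2 hN (by norm_num)
            (by unfold ratioMu; rw [← hσ, hncast]; field_simp) (hmu hm)
      refine ⟨T, hT, fun _ => hc.trans_eq ?_⟩
      have := ratioMu_nonneg ha (k + 1)
      rw [pow_div_eq_exp (by linarith) hδ, volMu, hncast]
  obtain ⟨TL, hTL, cTL⟩ : ∃ T : Finset ℝ, (∀ x ∈ Set.Icc B.Lm B.Lp, ∃ y ∈ T,
      |Real.log x - y| ≤ δ / (60 * n')) ∧
      (m.L ≠ Status.known → (T.card : ℝ) ≤
        Real.exp (volL B (k + 1) + 1 * Real.log (1 / δ))) := by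
    by_cases hm : m.L = Status.known
    · obtain ⟨T, hT, -⟩ := exists_volume_net
        (show 0 < δ / (60 * n') by positivity) hLm hL fun N hN => show N ≤ _ from
          hN.elim (fun h => h.trans (le_max_left 1
            (Real.log (B.Lp / B.Lm) / (2 * (δ / (60 * n'))) + 1)))
            fun h => h.2.trans (le_max_right _ _)
      exact ⟨T, hT, fun h => absurd hm h⟩
    · obtain ⟨T, hT, hc⟩ := exists_volume_net
        (show 0 < δ / (60 * n') by positivity) hLm hL (M := (1 + ratioL B (k + 1)) / δ)
          fun N hN => card_le_one_add_div (κ := 13 / 10) hδ hδ2 hN (by norm_num)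
            (by unfold ratioL; rw [hncast]; field_simp; ring) (hvol hm)
      refine ⟨T, hT, fun _ => hc.trans_eq ?_⟩
      have := ratioL_nonneg hLm hL (k + 1)
      have e := pow_div_eq_exp (show 0 < 1 + ratioL B (k + 1) by linarith) hδ 1
      rw [pow_one, Nat.cast_one, one_mul] at e
      rw [e, volL]
  obtain ⟨TD, hTD, cTD⟩ := exists_rotation_net (k + 1)
    (show 0 < δ / (31 * n' * ρ) by positivity) (M := 252 * ρ * n' / δ) (by
      -- `8 * 31 = 248`, and the remaining `4 ρ n` of `252 ρ n` pays for the term `1`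
      have h1 : 1 ≤ ρ * n' := one_le_mul_of_one_le_of_one_le hρ1 hn1
      rw [le_div_iff₀ hδ]
      have : (1 + 8 / (δ / (31 * n' * ρ))) * δ = δ + 248 * (ρ * n') := by field_simp; ring
      rw [this]
      linarith)
  have cTD' : (TD.card : ℝ) ≤
      Real.exp (volD 1 B (k + 1) + n' * (n' - 1) / 2 * Real.log (1 / δ)) := by
    refine cTD.trans_eq ?_
    have hd : (((k + 1) * (k + 1 - 1) / 2 : ℕ) : ℝ) = n' * (n' - 1) / 2 := by
      rw [← Nat.choose_two_right, Nat.cast_choose_two, hncast]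
    rw [pow_div_eq_exp (by positivity) hδ, hd, volD, hncast, Real.log_one, mul_zero, zero_div,
      zero_add, ← hρ]
  obtain ⟨TA, hTA, cTA⟩ := exists_shape_net (k := k) (s := δ / (255 * ρ * n'))
    (by positivity) hlm hl (M := (2 + 255 * ρ * Real.log ρ * n') / δ) (by
      rw [← hρ, le_div_iff₀ hδ, add_mul]
      have : Real.log ρ / (δ / (255 * ρ * n')) * δ = 255 * ρ * Real.log ρ * n' := by
        field_simp
      rw [this]
      linarith)
  have cTA' : (TA.card : ℝ) ≤ Real.exp (volA B (k + 1) + (n' - 1) * Real.log (1 / δ)) := by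
    refine cTA.trans_eq ?_
    have hd : (k : ℝ) = n' - 1 := by rw [hn']; ring
    rw [pow_div_eq_exp (by positivity) hδ, hd, volA, hncast, ← hρ]
  -- nets for the tuples, and their product
  obtain ⟨Jμ, cJμ, hJμ⟩ := Status.exists_net hK m.mu θ₀.mu
    (cov := fun y x => ∀ i, |b.repr (x - y) i| ≤ δ * σ / (83 * n')) hTμ cTμ
  obtain ⟨JL, cJL, hJL⟩ := Status.exists_net hK m.L θ₀.L
    (cov := fun y x => |Real.log x - y| ≤ δ / (60 * n')) hTL cTL
  obtain ⟨JD, cJD, hJD⟩ := Status.exists_net hK m.D θ₀.D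
    (cov := fun (R : {R : Matrix (Fin (k + 1)) (Fin (k + 1)) ℝ // Rᵀ * R = 1}) D =>
      ∃ s : Fin (k + 1) → ℝ, (∀ i, s i = 1 ∨ s i = -1) ∧
        ‖Matrix.diagonal s * Dᵀ - R.1ᵀ‖ ≤ δ / (31 * n' * ρ)) hTD fun _ => cTD'
  obtain ⟨JA, cJA, hJA⟩ := Status.exists_net hK m.A θ₀.A
    (cov := fun (c : {c : Fin (k + 1) → ℝ // ∑ i, c i = 0}) A =>
      ∀ i, |Real.log (A i) - c.1 i| ≤ shapeHalfWidth k (δ / (255 * ρ * n')) i) hTA fun _ => cTA'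
  let env : ℝ → ((Fin K → E) × (Fin K → ℝ) ×
      (Fin K → {R : Matrix (Fin (k + 1)) (Fin (k + 1)) ℝ // Rᵀ * R = 1}) ×
      (Fin K → {c : Fin (k + 1) → ℝ // ∑ i, c i = 0})) → Fin K → E → ℝ := fun σ j κ =>
    envelope b (j.1 κ) (j.2.1 κ) (j.2.2.1 κ).1 (j.2.2.2 κ).1
      (fun i => δ / (13 * n') + δ / (60 * n') + shapeHalfWidth k (δ / (255 * ρ * n')) i)
      (δ / 80 / 2 + (k + 1 : ℕ) * (δ / (60 * n')) / 2) σ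
  have henv0 : ∀ σ j κ y, 0 ≤ env σ j κ y := fun σ j κ y =>
    mul_nonneg (Real.exp_pos _).le (stretchedDensity_nonneg _ _ _ _ _ _ _)
  have henvm : ∀ σ j κ, Measurable (env σ j κ) := fun σ j κ =>
    ((continuous_stretchedDensity _ _ _ _ _ _).measurable).const_mul _
  have hmono : ∀ j κ y, env (-1) j κ y ≤ env 1 j κ y := by
    intro j κ y
    refine envelope_neg_one_le_one _ _ _ _ _ (fun i => ?_) (by positivity) y
    have := shapeHalfWidth_nonneg k (show 0 ≤ δ / (255 * ρ * n') by positivity) i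
    positivity
  refine bracketingEntropy_le_of_finset (Jμ ×ˢ JL ×ˢ JD ×ˢ JA) ?_ (env (-1)) (env 1) ?_ ?_
  · rw [Finset.card_product, Finset.card_product, Finset.card_product]
    push_cast
    refine (mul_le_mul cJμ (mul_le_mul cJL (mul_le_mul cJD cJA (Nat.cast_nonneg _)
      (Real.exp_nonneg _)) (by positivity) (Real.exp_nonneg _)) (by positivity)
      (Real.exp_nonneg _)).trans_eq ?_
    rw [← Real.exp_add, ← Real.exp_add, ← Real.exp_add, volTotal, dimTotal, hncast]
    congr 1
    ring
  · intro j _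
    refine ⟨⟨henvm _ j, henvm _ j, henv0 _ j, hmono j⟩, ?_⟩
    refine dMax_lt_ofReal (w := δ / 10) (by positivity) (by linarith) fun κ => ?_
    exact hellingerSq_envelope_cell_le b _ _ (j.2.2.1 κ).2 (j.2.2.2 κ).2 hδ hδ2 hρ1 hn'
  · rintro _ ⟨θ, ⟨h1, h2, h3, h4, h5, h6, h7, h8⟩, rfl⟩
    obtain ⟨tμ, htμ, cμ⟩ := hJμ θ.mu h5 h1
    obtain ⟨tL, htL, cL⟩ := hJL θ.L h6 h2
    obtain ⟨tD, htD, cD⟩ := hJD θ.D h7 h3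
    obtain ⟨tA, htA, cA⟩ := hJA θ.A h8 h4
    refine ⟨(tμ, tL, tD, tA), by simp only [Finset.mem_product]; exact ⟨htμ, htL, htD, htA⟩,
      fun κ y => ?_⟩
    obtain ⟨s, hs, hDR⟩ := cD κ
    exact envelope_cell_le_gaussDensity_le b hδ hδ2 hρ hn' hLm (h2 κ).1 (cL κ) hlm hl (h4 κ) (cA κ)
      ((Matrix.mem_orthogonalGroup_iff' _ _).1
        (Matrix.mem_specialOrthogonalGroup_iff.1 (h3 κ)).1) (tD κ).2 hs hDR (cμ κ) y

end EntropyBound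

end GaussEntropy


theorem mainTheorem8 :
    ∃ cS : ℝ, 0 < cS ∧
      ∀ (E : Type*) [NormedAddCommGroup E] [InnerProductSpace ℝ E] [FiniteDimensional ℝ E]
        [MeasurableSpace E] [BorelSpace E] (n K : ℕ) (b : OrthonormalBasis (Fin n) ℝ E)
        (B : GaussEntropy.Bounds) (m : GaussEntropy.ModelType) (θ₀ : GaussEntropy.Params E K n),
        1 ≤ n → 1 ≤ K → 0 ≤ B.a → 0 < B.Lm → B.Lm ≤ B.Lp → 0 < B.lm → B.lm ≤ B.lp →
        ∀ δ : ℝ, 0 < δ → δ ≤ Real.sqrt 2 →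
          ((m.mu ≠ GaussEntropy.Status.known → δ ≤ 1 + GaussEntropy.ratioMu B n) →
            (m.L ≠ GaussEntropy.Status.known → δ ≤ 1 + GaussEntropy.ratioL B n) →
            GaussEntropy.bracketingEntropy (δ / 9) (GaussEntropy.gaussFamily b m B θ₀) ≤
              ((GaussEntropy.volTotal cS m B K n +
                GaussEntropy.dimTotal m K n * Real.log (1 / δ) : ℝ) : EReal)) ∧
          GaussEntropy.bracketingEntropy (δ / 9) (GaussEntropy.gaussFamily b m B θ₀) ≤
            ((GaussEntropy.volTotal cS m B K n +
              GaussEntropy.dimTotal m K n * max (Real.log (1 / δ)) 0 : ℝ) : EReal) := by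
  refine ⟨1, one_pos, ?_⟩
  intro E _ _ _ _ _ n K b B m θ₀ hn hK ha hLm hL hlm hl δ hδ hδ2
  refine ⟨fun hmu hvol => GaussEntropy.bracketingEntropy_gaussFamily_le b B m θ₀ hn hK ha hLm hL
    hlm hl hδ hδ2 hmu hvol, ?_⟩
  -- without the restriction, `δ` is replaced by `min δ 1`
  have hmin : 0 < min δ 1 := lt_min hδ one_pos
  have hlog : max (Real.log (1 / δ)) 0 = Real.log (1 / min δ 1) := by
    rcases le_total δ 1 with h | h
    · rw [min_eq_left h, max_eq_left (Real.log_nonneg ((one_le_div hδ).2 h))]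
    · rw [min_eq_right h, max_eq_right (Real.log_nonpos (by positivity) ((div_le_one hδ).2 h))]
      simp
  have hμ := GaussEntropy.ratioMu_nonneg ha n
  have hv := GaussEntropy.ratioL_nonneg hLm hL n
  rw [hlog]
  refine (GaussEntropy.bracketingEntropy_antitone
    (div_le_div_of_nonneg_right (min_le_left δ 1) (by norm_num)) _).trans
    (GaussEntropy.bracketingEntropy_gaussFamily_le b B m θ₀ hn hK ha hLm hL hlm hl hmin
      ((min_le_left _ _).trans hδ2) (fun _ => ?_) fun _ => ?_)
  · linarith [min_le_right δ 1]
  · linarith [min_le_right δ 1]
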